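/- Let $T>0$, let $A$ be a real orthogonal $2\times 2$ matrix, and for $X\in\{F,V\}$, $l=1,2$ let $a_{X,l},b_{X,l},\lambda_{X,l}>0$ and $X_0^{(l)}\in\mathbb R$ (deterministic initial values). On a probability space with measure $\mathcal Q$ let $Z^{F,1},Z^{F,2},Z^{V,1},Z^{V,2}$ be independent inverse Gaussian subordinators, i.e. Lévy processes with nondecreasing paths and $$E\big[e^{i\theta Z^{X,l}_t}\big]=\exp\big(t\,\Psi_{X,l}(\theta)\big),\qquad \Psi_{X,l}(\theta)=-a_{X,l}\Big(\sqrt{-2i\theta+b_{X,l}^2}-b_{X,l}\Big),$$ and let $F^{(l)},V^{(l)}$ be the Ornstein–Uhlenbeck processes $$dX^{(l)}_t=-\lambda_{X,l}X^{(l)}_t\,dt+dZ^{X,l}_{\lambda_{X,l}t}$$ started at $X_0^{(l)}$. Put $\Sigma_t=\mathrm{diag}(F_t)+A\,\mathrm{diag}(V_t)A'$, $\Sigma_T^+=\int_0^T\Sigma_t\,dt$, $M=\begin{pmatrix}1&-1\\-1&1\end{pmatrix}$ and $v_T^+=\mathrm{tr}(M\Sigma_T^+)$. For real $a\le b$ let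 $$\varphi_{v_T^+}(u,a,b)=E\big[e^{iuv_T^+}1_{[a,b]}(v_T^+)\big],\qquad u\in\mathbb R.$$ With principal square roots and logarithms, dropping the indices $X,l$, define for real $\tilde\theta\ne0$ $$I(\lambda T,\tilde\theta)=-\frac{2a}{\sqrt{i\lambda}}\Big[-T_2+\sqrt{i\lambda}\,b+\tfrac i2T_1G\Big]+\lambda abT,\qquad G=\log\Big(e^{-\lambda T}\frac{(T_1+i\sqrt{i\lambda}\,b)^2}{(T_1+iT_2)^2}\Big),$$ $$T_1=\sqrt{-2\tilde\theta-i\lambda b^2},\qquad T_2=\sqrt{2\tilde\theta(1-e^{-\lambda T})+i\lambda b^2},$$ and $I(\lambda T,0)=0$ (the limit as $\tilde\theta\to0$). For a real $2\times2$ matrix $\theta$, with $C_l$ the matrix having a one in position $(l,l)$ and zeros elsewhere, let $$K_1^+(\theta)=i\sum_{l=1}^2\theta_{ll}\lambda_{F,l}^{-1}(1-e^{-\lambda_{F,l}T})F_0^{(l)}+\sum_{l=1}^2I_F^{(l)}(\lambda_{F,l}T,\theta_{ll}),$$ $$K_2^+(\theta)=i\sum_{l=1}^2\mathrm{tr}(\theta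 AC_lA')\lambda_{V,l}^{-1}(1-e^{-\lambda_{V,l}T})V_0^{(l)}+\sum_{l=1}^2I_V^{(l)}(\lambda_{V,l}T,\mathrm{tr}(\theta AC_lA')),$$ $$g(x)=\exp\big(K_1^+(Mx)+K_2^+(Mx)\big),\qquad f(y,a,b)=\begin{cases}\dfrac{e^{iby}-e^{iay}}{y},&y\ne0,\\ i(b-a),&y=0.\end{cases}$$ Then $g$ is the characteristic function of $v_T^+$ and, for every $u\in\mathbb R$, with an absolutely convergent integral, $$\varphi_{v_T^+}(u,a,b)=-\frac{i}{2\pi}\int_{\mathbb R}f(y,a,b)\,g(u-y)\,dy.$$ Moreover, $x\mapsto K_1^+(Mx)$, $x\mapsto K_2^+(Mx)$ and $u\mapsto\varphi_{v_T^+}(u,a,b)$ are infinitely differentiable on $\mathbb R$ and, for every integer $n\ge1$, with absolutely convergent integrals, $$D^n\varphi_{v_T^+}(u,a,b)\big|_{u=0}=-\frac{i}{2\pi}\sum_{j=0}^{n-1}\binom{n-1}{j}\int_{\mathbb R}f(y,a,b)\big[D^{j+1}K_1^+(-My)+D^{j+1}K_2^+(-My)\big]D^{n-j-1}g(-y)\,dy,$$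 where $D^jK_l^+(-My)$ and $D^jg(-y)$ denote the $j$-th derivatives of $K_l^+(M(u-y))$ and $g(u-y)$ with respect to $u$ at $u=0$. These derivatives give the constrained moments: for every integer $n\ge0$, $$D^n\varphi_{v_T^+}(u,a,b)\big|_{u=0}=i^n\,E\big[(v_T^+)^n1_{[a,b]}(v_T^+)\big].$$ -/

import Mathlib

open MeasureTheory ProbabilityTheory Filter Topology
open scoped NNReal

namespace OUCov

/-! ### Lévy processes and inverse Gaussian subordinators -/

/-- Real-valued Lévy processes, with respect to their own filtration: they start at `0`, have
independent and stationary increments, and almost surely càdlàg paths. -/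
structure IsLevyProcess {Ω : Type*} [MeasurableSpace Ω] (Z : ℝ≥0 → Ω → ℝ) (Q : Measure Ω) :
    Prop where
  measurable : ∀ t, Measurable (Z t)
  zero : ∀ᵐ ω ∂Q, Z 0 ω = 0
  indep_increments : HasIndepIncrements Z Q
  stationary : ∀ s t, IdentDistrib (fun ω => Z (s + t) ω - Z s ω) (Z t) Q Q
  cadlag : ∀ᵐ ω ∂Q, ∀ t, ContinuousWithinAt (fun s => Z s ω) (Set.Ici t) t ∧
    ∃ l, Tendsto (fun s => Z s ω) (𝓝[<] t) (𝓝 l)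

/-- The characteristic exponent `Ψ(θ) = -a (√(-2iθ + b²) - b)` of the inverse Gaussian
subordinator (principal square root). -/
noncomputable def igExponent (a b θ : ℝ) : ℂ :=
  -a * (Complex.sqrt (-2 * Complex.I * θ + b ^ 2) - b)

/-- Inverse Gaussian subordinators: Lévy processes with nondecreasing paths and
`E[exp(iθ Z_t)] = exp(t Ψ(θ))`. -/
structure IsIGSubordinator {Ω : Type*} [MeasurableSpace Ω] (a b : ℝ) (Z : ℝ≥0 → Ω → ℝ)
    (Q : Measure Ω) : Prop extends IsLevyProcess Z Q where
  mono : ∀ᵐ ω ∂Q, Monotone (fun t => Z t ω)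
  charFun_eq : ∀ (t : ℝ≥0) (θ : ℝ),
    ∫ ω, Complex.exp (Complex.I * θ * Z t ω) ∂Q = Complex.exp (t * igExponent a b θ)

/-! ### The Ornstein-Uhlenbeck covariance model -/

/-- Parameters of one factor: `a, b` of its inverse Gaussian subordinator, the mean reversion
rate `lam`, and the deterministic initial value `x0`. -/
structure FactorParams where
  a : ℝ
  b : ℝ
  lam : ℝ
  x0 : ℝ
  a_pos : 0 < a
  b_pos : 0 < b
  lam_pos : 0 < lam

/-- `X` solves `dX_t = -λ X_t dt + dZ_{λt}` with `X_0 = x0`, i.e. almost surely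
`X_t = x0 - λ ∫_0^t X_s ds + Z_{λt}` for all `t ≥ 0`. -/
structure IsOUProcess {Ω : Type*} [MeasurableSpace Ω] (p : FactorParams) (Z X : ℝ≥0 → Ω → ℝ)
    (Q : Measure Ω) : Prop where
  aemeasurable : ∀ t, AEMeasurable (X t) Q
  integrable : ∀ᵐ ω ∂Q, ∀ t : ℝ≥0,
    IntervalIntegrable (fun s : ℝ => X s.toNNReal ω) volume 0 t
  eq : ∀ᵐ ω ∂Q, ∀ t : ℝ≥0,
    X t ω = p.x0 - p.lam * (∫ s in (0 : ℝ)..t, X s.toNNReal ω) + Z (p.lam.toNNReal * t) ω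

/-- The covariance process `Σ_t = diag(F_t) + A diag(V_t) A'`. -/
def covProcess {Ω : Type*} (A : Matrix (Fin 2) (Fin 2) ℝ) (F V : Fin 2 → ℝ≥0 → Ω → ℝ)
    (t : ℝ≥0) (ω : Ω) : Matrix (Fin 2) (Fin 2) ℝ :=
  Matrix.diagonal (fun l => F l t ω) + A * Matrix.diagonal (fun l => V l t ω) * A.transpose

/-- The integrated covariance process `Σ_T^+ = ∫_0^T Σ_t dt`, entry by entry. -/
noncomputable def intCov {Ω : Type*} (A : Matrix (Fin 2) (Fin 2) ℝ) (F V : Fin 2 → ℝ≥0 → Ω → ℝ)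
    (T : ℝ) (ω : Ω) : Matrix (Fin 2) (Fin 2) ℝ :=
  Matrix.of fun j k => ∫ t in (0 : ℝ)..T, covProcess A F V t.toNNReal ω j k

/-- The matrix `M`. -/
def matM : Matrix (Fin 2) (Fin 2) ℝ := !![1, -1; -1, 1]

/-- `v_T^+ = tr(M Σ_T^+)`. -/
noncomputable def vPlus {Ω : Type*} (A : Matrix (Fin 2) (Fin 2) ℝ) (F V : Fin 2 → ℝ≥0 → Ω → ℝ)
    (T : ℝ) (ω : Ω) : ℝ :=
  (matM * intCov A F V T ω).trace

/-- The characteristic function of `X` constrained to `[a, b]`: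
`u ↦ E[exp(iuX) 1_{[a,b]}(X)]`. -/
noncomputable def constrainedCharFun {Ω : Type*} [MeasurableSpace Ω] (Q : Measure Ω) (X : Ω → ℝ)
    (a b u : ℝ) : ℂ :=
  ∫ ω, Complex.exp (Complex.I * u * X ω) * (Set.Icc a b).indicator (fun _ => (1 : ℂ)) (X ω) ∂Q

/-! ### The closed form of the characteristic function

All square roots and logarithms are principal. -/

/-- `T₁(θ) = √(-2θ - iλb²)`. -/
noncomputable def T1 (p : FactorParams) (θ : ℝ) : ℂ :=
  Complex.sqrt (-2 * θ - Complex.I * p.lam * p.b ^ 2)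

/-- `T₂(t, θ) = √(2θ(1 - exp(-λt)) + iλb²)`. -/
noncomputable def T2 (p : FactorParams) (t θ : ℝ) : ℂ :=
  Complex.sqrt (2 * θ * (1 - Real.exp (-p.lam * t)) + Complex.I * p.lam * p.b ^ 2)

/-- `G(θ) = log(exp(-λt) (T₁ + i √(iλ) b)² / (T₁ + i T₂)²)`. -/
noncomputable def G (p : FactorParams) (t θ : ℝ) : ℂ :=
  Complex.log (Real.exp (-p.lam * t) *
    (T1 p θ + Complex.I * Complex.sqrt (Complex.I * p.lam) * p.b) ^ 2 /
      (T1 p θ + Complex.I * T2 p t θ) ^ 2)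

/-- `I(λt, θ)`. The closed form is for `θ ≠ 0` (at `θ = 0` it reads `log(0/0)`); at `θ = 0` the
value is the limit `0`. -/
noncomputable def igInt (p : FactorParams) (t θ : ℝ) : ℂ :=
  if θ = 0 then 0 else
    -(2 * p.a / Complex.sqrt (Complex.I * p.lam)) *
      (-T2 p t θ + Complex.sqrt (Complex.I * p.lam) * p.b +
        Complex.I / 2 * T1 p θ * G p t θ) + p.lam * p.a * p.b * t

/-- `K₁^+(θ)`, for a `2 × 2` matrix `θ`. -/
noncomputable def K1 (pF : Fin 2 → FactorParams) (t : ℝ) (θ : Matrix (Fin 2) (Fin 2) ℝ) : ℂ :=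
  Complex.I * ∑ l, ((θ l l * (pF l).lam⁻¹ * (1 - Real.exp (-(pF l).lam * t)) * (pF l).x0 : ℝ) : ℂ)
    + ∑ l, igInt (pF l) t (θ l l)

/-- `tr(θ A C_l A')`, where `C_l` has a one in position `(l, l)` and zeros elsewhere. -/
def loading (A θ : Matrix (Fin 2) (Fin 2) ℝ) (l : Fin 2) : ℝ :=
  (θ * A * Matrix.single l l (1 : ℝ) * A.transpose).trace

/-- `K₂^+(θ)`, for a `2 × 2` matrix `θ`. -/
noncomputable def K2 (pV : Fin 2 → FactorParams) (A : Matrix (Fin 2) (Fin 2) ℝ) (t : ℝ)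
    (θ : Matrix (Fin 2) (Fin 2) ℝ) : ℂ :=
  Complex.I * ∑ l,
      ((loading A θ l * (pV l).lam⁻¹ * (1 - Real.exp (-(pV l).lam * t)) * (pV l).x0 : ℝ) : ℂ)
    + ∑ l, igInt (pV l) t (loading A θ l)

/-- `g(x) = exp(K₁^+(Mx) + K₂^+(Mx))`. -/
noncomputable def g (pF pV : Fin 2 → FactorParams) (A : Matrix (Fin 2) (Fin 2) ℝ) (T x : ℝ) : ℂ :=
  Complex.exp (K1 pF T (x • matM) + K2 pV A T (x • matM))

/-- `f(y, a, b) = (exp(iby) - exp(iay)) / y`, and `i (b - a)` at `y = 0`. -/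
noncomputable def f (y a b : ℝ) : ℂ :=
  if y = 0 then Complex.I * (b - a)
  else (Complex.exp (Complex.I * b * y) - Complex.exp (Complex.I * a * y)) / y

/-- The integrand
`f(y,a,b) [D^{j+1} K₁^+(-My) + D^{j+1} K₂^+(-My)] D^{n-j-1} g(-y)` of the derivative formula,
where `D` is the derivative in `u` of functions of `u - y`, evaluated at `u = 0`. -/
noncomputable def derivIntegrand (pF pV : Fin 2 → FactorParams) (A : Matrix (Fin 2) (Fin 2) ℝ)
    (T a b : ℝ) (n j : ℕ) (y : ℝ) : ℂ :=
  f y a b *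
    (iteratedDeriv (j + 1) (fun u : ℝ => K1 pF T ((u - y) • matM)) 0 +
      iteratedDeriv (j + 1) (fun u : ℝ => K2 pV A T ((u - y) • matM)) 0) *
    iteratedDeriv (n - j - 1) (fun u : ℝ => g pF pV A T (u - y)) 0

end OUCov

namespace OUCov

/-! The Ornstein-Uhlenbeck equation is linear, so pathwise `∫₀ᵀ X` is a constant plus `∫₀ᵀ
exp(-λ(T-s)) Z_{λs} ds`, which by parts is the integral of the deterministic function `weight`
against `dZ_{λs}`. Approximating it by weighted sums of increments, independence and stationarity
give its characteristic function: the exponent is an integral of `Ψ` along the weights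
(`integral_exp_sum_integral_ou`). Since `v_T^+` is almost surely a linear combination of the four
independent integrals (`ae_vPlus_eq`), its characteristic function is `g`, once the closed form is
known to equal that integral of `Ψ`.

That is `igInt_eq_integral`. The closed form is the increment of an antiderivative; the delicate
point is that principal branches stay valid along the whole path. It holds because `T₁ + iT₂` never
leaves one open quadrant (`quadrant`), which keeps the argument of the logarithm off the cut.

The integral form also controls `g`. The real part of `Ψ(θ)` is at most a constant minus a multiple
of `√|θ|`, so `g` decays like `exp(-c√|x|)`, while all derivatives of `Ψ` of order at least one are
bounded. As `g' = K'g`, every derivative of `g` is `g` times a bounded function and is dominated by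
a multiple of `1/(1+x²)` (`g_regularity`).

An integrable characteristic function can be inverted: on `[a, b]` the law may be replaced by the
Fourier transform of its characteristic function, and Fubini produces the kernel `f`
(`setIntegral_exp_eq_integral_f`). The decay permits differentiation under the integral, and
Leibniz' rule for `K'g` gives the sum. The moment identity is independent of the inversion: the
constrained function is the characteristic function of the law restricted to a compact interval,
which has all moments. -/

/-! ### Principal square roots -/

theorem sqrt_sq (z : ℂ) : Complex.sqrt z ^ 2 = z := by
  simp [Complex.sqrt]

theorem sqrt_re_nonneg (z : ℂ) : 0 ≤ (Complex.sqrt z).re := by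
  rw [Complex.sqrt, Complex.cpow_inv_two_re]
  positivity

/-- A complex number with nonnegative real part whose square is off the negative axis is the
principal square root of its square. -/
theorem eq_sqrt_of_sq {z w : ℂ} (hw : 0 < w.re) (h : w ^ 2 = z) : w = Complex.sqrt z := by
  have h1 : (Complex.sqrt z) ^ 2 = w ^ 2 := by rw [sqrt_sq, h]
  rcases sq_eq_sq_iff_eq_or_eq_neg.1 h1 with h2 | h2
  · exact h2.symm
  · have h3 := sqrt_re_nonneg z
    rw [h2] at h3
    simp at h3
    linarith

theorem sqrt_re_im_of_im_pos {z : ℂ} (hz : 0 < z.im) :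
    0 < (Complex.sqrt z).re ∧ 0 < (Complex.sqrt z).im := by
  have h1 := sqrt_sq z
  have h2 := congrArg Complex.im h1
  have h0 := sqrt_re_nonneg z
  simp only [pow_two, Complex.mul_im] at h2
  have h3 : 0 < (Complex.sqrt z).re * (Complex.sqrt z).im := by linarith
  have h4 : 0 < (Complex.sqrt z).re := lt_of_le_of_ne h0 (by rintro h; rw [← h] at h3; simp at h3)
  exact ⟨h4, (pos_iff_pos_of_mul_pos h3).1 h4⟩

theorem sqrt_re_im_of_im_neg {z : ℂ} (hz : z.im < 0) :
    0 < (Complex.sqrt z).re ∧ (Complex.sqrt z).im < 0 := by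
  have h1 := sqrt_sq z
  have h2 := congrArg Complex.im h1
  have h0 := sqrt_re_nonneg z
  simp only [pow_two, Complex.mul_im] at h2
  have h3 : (Complex.sqrt z).re * (Complex.sqrt z).im < 0 := by linarith
  have h4 : 0 < (Complex.sqrt z).re := lt_of_le_of_ne h0 (by rintro h; rw [← h] at h3; simp at h3)
  exact ⟨h4, by nlinarith⟩

theorem hasDerivAt_complex_sqrt {z : ℂ} (hz : z ∈ Complex.slitPlane) :
    HasDerivAt Complex.sqrt (1 / (2 * Complex.sqrt z)) z := by
  convert Complex.hasDerivAt_sqrt hz using 1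
  rw [show (-1 / 2 : ℂ) = -(2⁻¹) by norm_num, Complex.cpow_neg, ← Complex.sqrt]
  field_simp

/-! ### The closed form as an integral of the exponent -/

/-- The square root `√(2θ(1 - exp(-s)) + iλb²)`. -/
noncomputable def rootPath (p : FactorParams) (θ s : ℝ) : ℂ :=
  Complex.sqrt (2 * θ * (1 - Real.exp (-s)) + Complex.I * p.lam * p.b ^ 2)

theorem T2_eq_rootPath (p : FactorParams) (t θ : ℝ) : T2 p t θ = rootPath p θ (p.lam * t) := by
  simp [T2, rootPath]

theorem rootPath_sq (p : FactorParams) (θ s : ℝ) :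
    rootPath p θ s ^ 2 = 2 * θ * (1 - Real.exp (-s)) + Complex.I * p.lam * p.b ^ 2 := sqrt_sq _

theorem T1_sq (p : FactorParams) (θ : ℝ) :
    T1 p θ ^ 2 = -2 * θ - Complex.I * p.lam * p.b ^ 2 := sqrt_sq _

theorem radicand_im (p : FactorParams) (θ s : ℝ) :
    (2 * θ * (1 - Real.exp (-s)) + Complex.I * p.lam * p.b ^ 2 : ℂ).im = p.lam * p.b ^ 2 := by
  have : (2 * θ * (1 - Real.exp (-s)) + Complex.I * p.lam * p.b ^ 2 : ℂ) =
    ((2 * θ * (1 - Real.exp (-s)) : ℝ) : ℂ) + ((p.lam * p.b ^ 2 : ℝ) : ℂ) * Complex.I := by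
    push_cast; ring
  rw [this, Complex.add_im, Complex.ofReal_im, Complex.im_ofReal_mul, Complex.I_im]
  ring

theorem radicand_im_pos (p : FactorParams) (θ s : ℝ) :
    0 < (2 * θ * (1 - Real.exp (-s)) + Complex.I * p.lam * p.b ^ 2 : ℂ).im := by
  rw [radicand_im]
  have := p.lam_pos; have := p.b_pos; positivity

theorem rootPath_re_im (p : FactorParams) (θ s : ℝ) :
    0 < (rootPath p θ s).re ∧ 0 < (rootPath p θ s).im :=
  sqrt_re_im_of_im_pos (radicand_im_pos p θ s)

theorem T1_re_im (p : FactorParams) (θ : ℝ) : 0 < (T1 p θ).re ∧ (T1 p θ).im < 0 := by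
  refine sqrt_re_im_of_im_neg ?_
  have : (-2 * θ - Complex.I * p.lam * p.b ^ 2 : ℂ) =
    ((-2 * θ : ℝ) : ℂ) + ((-(p.lam * p.b ^ 2) : ℝ) : ℂ) * Complex.I := by
    push_cast; ring
  rw [this, Complex.add_im, Complex.ofReal_im, Complex.im_ofReal_mul, Complex.I_im]
  have : 0 < p.lam * p.b ^ 2 := mul_pos p.lam_pos (pow_pos p.b_pos 2)
  linarith

theorem sqrt_I_mul_re_im (p : FactorParams) :
    0 < (Complex.sqrt (Complex.I * p.lam)).re ∧
    (Complex.sqrt (Complex.I * p.lam)).im = (Complex.sqrt (Complex.I * p.lam)).re := by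
  have h := sqrt_re_im_of_im_pos (z := Complex.I * p.lam) (by simpa using p.lam_pos)
  refine ⟨h.1, ?_⟩
  have h1 := congrArg Complex.re (sqrt_sq (Complex.I * p.lam))
  simp [pow_two] at h1
  nlinarith [h.1, h.2]

/-- The term `√(iλ) b` of the closed form is the starting value of the path whose endpoint is `T₂`;
this makes the closed form a difference of two values of one antiderivative. -/
theorem rootPath_zero (p : FactorParams) (θ : ℝ) :
    Complex.sqrt (Complex.I * p.lam) * p.b = rootPath p θ 0 := by
  refine eq_sqrt_of_sq ?_ ?_
  · have := (sqrt_I_mul_re_im p).1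
    have := p.b_pos
    simp; positivity
  · rw [mul_pow, sqrt_sq]; simp

/-- The principal square root in the exponent and the one in the closed form differ by the
factor `√(iλ)`. -/
theorem sqrt_I_mul_mul_sqrt (p : FactorParams) (θ s : ℝ) :
    Complex.sqrt (Complex.I * p.lam) *
      Complex.sqrt (-2 * Complex.I * (θ / p.lam * (1 - Real.exp (-s)) : ℝ) + p.b ^ 2) =
      rootPath p θ s := by
  have hl := p.lam_pos
  have hb := p.b_pos
  set w := Complex.sqrt (-2 * Complex.I * (θ / p.lam * (1 - Real.exp (-s)) : ℝ) + p.b ^ 2) with hw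
  have h1 := sqrt_sq (-2 * Complex.I * (θ / p.lam * (1 - Real.exp (-s)) : ℝ) + p.b ^ 2 : ℂ)
  rw [← hw] at h1
  have h2 := congrArg Complex.re h1
  have e : (-2 * Complex.I * (θ / p.lam * (1 - Real.exp (-s)) : ℝ) + p.b ^ 2 : ℂ).re = p.b ^ 2 := by
    have : (-2 * Complex.I * (θ / p.lam * (1 - Real.exp (-s)) : ℝ) + p.b ^ 2 : ℂ) =
      ((p.b ^ 2 : ℝ) : ℂ) + ((-2 * (θ / p.lam * (1 - Real.exp (-s))) : ℝ) : ℂ) * Complex.I := by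
      push_cast; ring
    rw [this, Complex.add_re, Complex.ofReal_re, Complex.re_ofReal_mul, Complex.I_re]
    ring
  rw [e] at h2
  simp only [pow_two, Complex.mul_re] at h2
  have h0 : 0 ≤ w.re := sqrt_re_nonneg _
  refine eq_sqrt_of_sq ?_ ?_
  -- As `√(iλ)` is a positive multiple of `1 + i`, the sign to check is that of `Re w - Im w`. It is
  -- positive because `(Re w)² - (Im w)² = b² > 0` and `Re w ≥ 0`.
  · obtain ⟨h3, h4⟩ := sqrt_I_mul_re_im p
    rw [Complex.mul_re, h4, ← mul_sub]
    have : 0 < w.re - w.im := by nlinarith [mul_pos hb hb]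
    positivity
  · rw [mul_pow, sqrt_sq, h1]
    have : (p.lam : ℂ) ≠ 0 := by exact_mod_cast hl.ne'
    push_cast
    field_simp
    linear_combination (-2 * θ * (1 - Complex.exp (-(s:ℂ)))) * Complex.I_sq

/-- `T₁ + iT₂` stays in one open quadrant. -/
theorem quadrant (p : FactorParams) (θ : ℝ) (s : ℝ) :
    (0 < θ → (T1 p θ + Complex.I * rootPath p θ s).re < 0 ∧
      (T1 p θ + Complex.I * rootPath p θ s).im < 0) ∧
    (θ < 0 → 0 < (T1 p θ + Complex.I * rootPath p θ s).re ∧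
      0 < (T1 p θ + Complex.I * rootPath p θ s).im) := by
  obtain ⟨hp, hq⟩ := T1_re_im p θ
  obtain ⟨hc, hd⟩ := rootPath_re_im p θ s
  have h1 := T1_sq p θ
  have h2 := rootPath_sq p θ s
  -- The sum of squares is real. With `T₁ = P - iq` and root `c + id`, its imaginary part gives `cd
  -- = Pq`, and the sign of its real part then orders `c, q` and `P, d`. The two coordinates in
  -- question are `P - d` and `c - q`.
  have h3 : T1 p θ ^ 2 + rootPath p θ s ^ 2 = ((-2 * θ * Real.exp (-s) : ℝ) : ℂ) := by
    rw [h1, h2]; push_cast; ring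
  have h4 := congrArg Complex.re h3
  have h5 := congrArg Complex.im h3
  rw [Complex.ofReal_re] at h4
  rw [Complex.ofReal_im] at h5
  simp only [pow_two, Complex.add_re, Complex.add_im, Complex.mul_re, Complex.mul_im] at h4 h5
  simp only [Complex.add_re, Complex.add_im, Complex.mul_re, Complex.mul_im, Complex.I_re,
    Complex.I_im]
  have he := Real.exp_pos (-s)
  generalize (T1 p θ).re = P at *
  generalize (T1 p θ).im = R at *
  generalize (rootPath p θ s).re = c at *
  generalize (rootPath p θ s).im = d at *
  obtain ⟨q, rfl⟩ : ∃ q, R = -q := ⟨-R, by simp⟩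
  have hq' : 0 < q := by linarith
  have key : c * d = P * q := by linarith
  constructor
  · intro h
    have h6 : 0 < 2 * θ * Real.exp (-s) := by positivity
    have hcq : c < q := by
      by_contra! hh
      have : d ≤ P := by
        by_contra! h7
        nlinarith [mul_lt_mul_of_pos_left h7 hc]
      nlinarith
    have : P < d := by
      by_contra! hh
      nlinarith
    constructor <;> linarith
  · intro h
    have h6 : 2 * θ * Real.exp (-s) < 0 := by nlinarith
    have hcq : q < c := by
      by_contra! hh
      have : P ≤ d := by
        by_contra! h7
        nlinarith [mul_lt_mul_of_pos_left h7 hc]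
      nlinarith
    have : d < P := by
      by_contra! hh
      nlinarith
    constructor <;> linarith

/-- Two numbers in the same open quadrant differ in argument by less than a right angle, so their
quotient has positive real part. -/
theorem quadrant_pos (p : FactorParams) {θ : ℝ} (hθ : θ ≠ 0) (s : ℝ) :
    T1 p θ + Complex.I * rootPath p θ s ≠ 0 ∧
    0 < ((T1 p θ + Complex.I * rootPath p θ 0) / (T1 p θ + Complex.I * rootPath p θ s)).re := by
  have h1 := quadrant p θ 0
  have h2 := quadrant p θ s
  generalize T1 p θ + Complex.I * rootPath p θ 0 = w at *
  generalize T1 p θ + Complex.I * rootPath p θ s = z at *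
  have h0 : z ≠ 0 := by
    rintro rfl
    rcases lt_or_gt_of_ne hθ with h | h
    · exact lt_irrefl _ (h2.2 h).1
    · exact lt_irrefl _ (h2.1 h).1
  refine ⟨h0, ?_⟩
  have hn : 0 < Complex.normSq z := Complex.normSq_pos.2 h0
  rw [Complex.div_re, ← add_div]
  refine div_pos ?_ hn
  rcases lt_or_gt_of_ne hθ with h | h
  · have := h1.2 h; have := h2.2 h; nlinarith
  · have := h1.1 h; have := h2.1 h; nlinarith

theorem sq_mem_slitPlane {z : ℂ} (hz : 0 < z.re) : z ^ 2 ∈ Complex.slitPlane := by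
  rw [Complex.mem_slitPlane_iff]
  by_cases h : z.im = 0
  · left; simp [pow_two, h]; positivity
  · right; simp only [pow_two, Complex.mul_im]
    have : z.re * z.im ≠ 0 := mul_ne_zero hz.ne' h
    intro h2; apply this; linarith

/-- The argument of the logarithm along the path. -/
noncomputable def logArg (p : FactorParams) (θ s : ℝ) : ℂ :=
  Real.exp (-s) * (T1 p θ + Complex.I * rootPath p θ 0) ^ 2 /
      (T1 p θ + Complex.I * rootPath p θ s) ^ 2

/-- It is the square of a number in the open right half-plane. Hence the principal logarithm is
differentiable along the path, with no branch correction. -/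
theorem logArg_mem_slitPlane (p : FactorParams) {θ : ℝ} (hθ : θ ≠ 0) (s : ℝ) :
    logArg p θ s ∈ Complex.slitPlane := by
  have h := (quadrant_pos p hθ s).2
  have e : logArg p θ s = ((Real.exp (-s / 2) : ℝ) *
      ((T1 p θ + Complex.I * rootPath p θ 0) / (T1 p θ + Complex.I * rootPath p θ s))) ^ 2 := by
    rw [mul_pow, ← Complex.ofReal_pow, ← Real.exp_nat_mul, logArg, div_pow, mul_div_assoc]
    congr 3; push_cast; ring
  rw [e]
  refine sq_mem_slitPlane ?_
  rw [Complex.re_ofReal_mul]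
  positivity

theorem hasDerivAt_rootPath (p : FactorParams) (θ s : ℝ) :
    HasDerivAt (rootPath p θ) (θ * Real.exp (-s) / rootPath p θ s) s := by
  have h1 : HasDerivAt (fun s : ℝ => (2 * θ * (1 - Real.exp (-s)) + Complex.I * p.lam * p.b ^ 2 : ℂ))
      (2 * θ * Real.exp (-s)) s := by
    have h2 : HasDerivAt (fun s : ℝ => 2 * θ * (1 - Real.exp (-s))) (2 * θ * Real.exp (-s)) s := by
      exact (((hasDerivAt_neg s).exp).const_sub 1).const_mul (2 * θ) |>.congr_deriv (by ring)
    have h3 := h2.ofReal_comp.add_const (Complex.I * p.lam * p.b ^ 2 : ℂ)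
    refine (h3.congr_deriv (by norm_cast)).congr_of_eventuallyEq (.of_forall fun s => ?_)
    push_cast; ring
  have h4 := (hasDerivAt_complex_sqrt (z := 2 * θ * (1 - Real.exp (-s)) + Complex.I * p.lam * p.b ^ 2)
    (Or.inr (radicand_im_pos p θ s).ne')).comp_of_eq s h1 rfl
  refine h4.congr_deriv ?_
  have : rootPath p θ s ≠ 0 := by
    intro h; have := (rootPath_re_im p θ s).1; rw [h] at this; simp at this
  rw [← rootPath]
  field_simp

theorem hasDerivAt_log_logArg (p : FactorParams) {θ : ℝ} (hθ : θ ≠ 0) (s : ℝ) :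
    HasDerivAt (fun s => Complex.log (logArg p θ s))
      (-1 - 2 * Complex.I * (θ * Real.exp (-s) / rootPath p θ s) /
        (T1 p θ + Complex.I * rootPath p θ s)) s := by
  have hz := (quadrant_pos p hθ s).1
  have hw := (quadrant_pos p hθ 0).1
  have h1 : HasDerivAt (fun s : ℝ => (Real.exp (-s) : ℂ)) (-(Real.exp (-s))) s := by
    have := ((hasDerivAt_neg s).exp).ofReal_comp
    convert this using 1; push_cast; ring
  have h2 := ((hasDerivAt_rootPath p θ s).const_mul Complex.I).const_add (T1 p θ)
  have h3 := ((h1.mul_const ((T1 p θ + Complex.I * rootPath p θ 0) ^ 2)).div (h2.pow 2)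
    (pow_ne_zero 2 hz))
  have h4 := h3.clog_real (logArg_mem_slitPlane p hθ s)
  refine h4.congr_deriv ?_
  have hr : rootPath p θ s ≠ 0 := by
    intro h; have := (rootPath_re_im p θ s).1; rw [h] at this; simp at this
  have he : (Real.exp (-s) : ℂ) ≠ 0 := by exact_mod_cast (Real.exp_pos _).ne'
  simp only [Pi.pow_apply, Pi.div_apply]
  generalize (Real.exp (-s) : ℂ) = e at *
  generalize T1 p θ + Complex.I * rootPath p θ s = z at *
  generalize T1 p θ + Complex.I * rootPath p θ 0 = w at *
  generalize rootPath p θ s = r at *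
  field_simp
  norm_num
  ring

theorem igInt_eq_integral (p : FactorParams) (t θ : ℝ) :
    igInt p t θ = ∫ s in (0 : ℝ)..(p.lam * t),
      igExponent p.a p.b (θ / p.lam * (1 - Real.exp (-s))) := by
  -- The separate value `0` at `θ = 0` is the right one because `Ψ(0) = 0`.
  by_cases hθ : θ = 0
  · have hb : Complex.sqrt ((p.b : ℂ) ^ 2) = p.b := by
      refine (eq_sqrt_of_sq ?_ rfl).symm
      simpa using p.b_pos
    simp [hθ, igInt, igExponent, hb]
  set κ := Complex.sqrt (Complex.I * p.lam) with hκ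
  have hκ0 : κ ≠ 0 := by
    intro h; have := (sqrt_I_mul_re_im p).1; rw [← hκ, h] at this; simp at this
  have hcont : Continuous (rootPath p θ) :=
    continuous_iff_continuousAt.2 fun s => (hasDerivAt_rootPath p θ s).continuousAt
  have hexp : ∀ s, igExponent p.a p.b (θ / p.lam * (1 - Real.exp (-s))) =
      -(p.a / κ) * rootPath p θ s + p.a * p.b := by
    intro s
    rw [← sqrt_I_mul_mul_sqrt, igExponent]
    field_simp
    ring
  have hder : ∀ s, HasDerivAt (fun s : ℝ => -(2 * p.a / κ) *
      (-rootPath p θ s + κ * p.b + Complex.I / 2 * T1 p θ * Complex.log (logArg p θ s)) +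
        p.a * p.b * (s : ℂ)) (-(p.a / κ) * rootPath p θ s + p.a * p.b) s := by
    intro s
    have h1 := hasDerivAt_rootPath p θ s
    have h2 := hasDerivAt_log_logArg p hθ s
    have h3 := (((h1.neg.add_const (κ * p.b)).add (h2.const_mul (Complex.I / 2 * T1 p θ))).const_mul
      (-(2 * p.a / κ))).add ((Complex.ofRealCLM.hasDerivAt (x := s)).const_mul (p.a * p.b : ℂ))
    refine h3.congr_deriv ?_
    have hz := (quadrant_pos p hθ s).1
    have hr : rootPath p θ s ≠ 0 := by
      intro h; have := (rootPath_re_im p θ s).1; rw [h] at this; simp at this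
    -- Factoring `T₁² + r² = -2θ exp(-s)` cancels the denominator `T₁ + ir` of the logarithmic
    -- derivative.
    have e : (θ : ℂ) * Real.exp (-s) = -(T1 p θ + Complex.I * rootPath p θ s) *
        (T1 p θ - Complex.I * rootPath p θ s) / 2 := by
      have : (T1 p θ + Complex.I * rootPath p θ s) *
        (T1 p θ - Complex.I * rootPath p θ s) = T1 p θ ^ 2 + rootPath p θ s ^ 2 := by
        ring_nf; rw [Complex.I_sq]; ring
      rw [neg_mul, this, T1_sq, rootPath_sq]; ring
    rw [e]
    simp only [Complex.ofRealCLM_apply]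
    generalize rootPath p θ s = r at *
    generalize T1 p θ = τ at *
    field_simp
    ring_nf
    simp only [Complex.I_sq, show Complex.I ^ 3 = -Complex.I by
      rw [pow_succ, Complex.I_sq]; ring]
    rw [Complex.ofReal_one]
    ring
  simp_rw [hexp]
  rw [intervalIntegral.integral_eq_sub_of_hasDerivAt (fun s _ => hder s)
    (Continuous.intervalIntegrable (by fun_prop) _ _)]
  have h0 : logArg p θ 0 = 1 := by
    have := (quadrant_pos p hθ 0).1
    simp only [logArg, neg_zero, Real.exp_zero, Complex.ofReal_one, one_mul]
    exact div_self (pow_ne_zero 2 this)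
  have hG : G p t θ = Complex.log (logArg p θ (p.lam * t)) := by
    rw [G, logArg, T2_eq_rootPath, ← rootPath_zero, mul_assoc, neg_mul]
  rw [h0, igInt, if_neg hθ, hG, T2_eq_rootPath, ← hκ, ← rootPath_zero p θ, ← hκ]
  simp
  ring

/-! ### Smooth functions with bounded derivatives -/

/-- Smooth functions all of whose derivatives, including the zeroth, are bounded. -/
def HasBddDerivs (h : ℝ → ℂ) : Prop :=
  ContDiff ℝ (⊤ : ℕ∞) h ∧ ∀ k : ℕ, ∃ C : ℝ, ∀ x, ‖iteratedDeriv k h x‖ ≤ C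

/-- Lets explicit families, each the derivative of its predecessor, be used in place of iterated
derivatives. -/
theorem iteratedDeriv_eq_of_chain {h : ℕ → ℝ → ℂ}
    (hd : ∀ k x, HasDerivAt (h k) (h (k + 1) x) x) (k : ℕ) : iteratedDeriv k (h 0) = h k := by
  induction k with
  | zero => simp
  | succ k ih => rw [iteratedDeriv_succ, ih]; exact funext fun x => (hd k x).deriv

theorem HasBddDerivs.of_chain {h : ℕ → ℝ → ℂ} (hd : ∀ k x, HasDerivAt (h k) (h (k + 1) x) x)
    (hb : ∀ k, ∃ C : ℝ, ∀ x, ‖h k x‖ ≤ C) : HasBddDerivs (h 0) := by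
  refine ⟨contDiff_of_differentiable_iteratedDeriv fun m _ => ?_, fun k => ?_⟩
  · rw [iteratedDeriv_eq_of_chain hd]; exact fun x => (hd m x).differentiableAt
  · rw [iteratedDeriv_eq_of_chain hd]; exact hb k

theorem HasBddDerivs.const (c : ℂ) : HasBddDerivs (fun _ => c) := by
  refine ⟨contDiff_const, fun k => ⟨‖c‖, fun x => ?_⟩⟩
  rw [iteratedDeriv_const]
  split_ifs <;> simp

theorem HasBddDerivs.add {f g : ℝ → ℂ} (hf : HasBddDerivs f) (hg : HasBddDerivs g) :
    HasBddDerivs (f + g) := by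
  refine ⟨hf.1.add hg.1, fun k => ?_⟩
  obtain ⟨C, hC⟩ := hf.2 k
  obtain ⟨D, hD⟩ := hg.2 k
  refine ⟨C + D, fun x => ?_⟩
  rw [iteratedDeriv_add (hf.1.of_le (by exact_mod_cast le_top)).contDiffAt
    (hg.1.of_le (by exact_mod_cast le_top)).contDiffAt]
  exact (norm_add_le _ _).trans (add_le_add (hC x) (hD x))

theorem HasBddDerivs.mul {f g : ℝ → ℂ} (hf : HasBddDerivs f) (hg : HasBddDerivs g) :
    HasBddDerivs (f * g) := by
  refine ⟨hf.1.mul hg.1, fun k => ?_⟩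
  choose C hC using hf.2
  choose D hD using hg.2
  refine ⟨∑ i ∈ Finset.range (k + 1), k.choose i * C i * D (k - i), fun x => ?_⟩
  rw [iteratedDeriv_mul (hf.1.of_le (by exact_mod_cast le_top)).contDiffAt
    (hg.1.of_le (by exact_mod_cast le_top)).contDiffAt]
  refine (norm_sum_le _ _).trans (Finset.sum_le_sum fun i _ => ?_)
  rw [norm_mul, norm_mul, Complex.norm_natCast]
  have := (norm_nonneg _).trans (hC i x)
  gcongr
  · exact hC i x
  · exact hD _ x

theorem HasBddDerivs.deriv {f : ℝ → ℂ} (hf : HasBddDerivs f) : HasBddDerivs (deriv f) := by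
  refine ⟨(contDiff_infty_iff_deriv.1 hf.1).2, fun k => ?_⟩
  rw [← iteratedDeriv_succ']
  exact hf.2 (k + 1)

theorem contDiff_of_hasDerivAt {f f' : ℝ → ℂ} (hd : ∀ x, HasDerivAt f (f' x) x)
    (hf' : HasBddDerivs f') : ContDiff ℝ (⊤ : ℕ∞) f := by
  refine contDiff_infty_iff_deriv.2 ⟨fun x => (hd x).differentiableAt, ?_⟩
  rw [funext fun x => (hd x).deriv]
  exact hf'.1

/-- The derivatives of a solution of `g' = K' g` are multiples of `g` by functions with bounded
derivatives. -/
theorem exists_iteratedDeriv_eq_mul {g K' : ℝ → ℂ} (hd : ∀ x, HasDerivAt g (K' x * g x) x)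
    (hK : HasBddDerivs K') (k : ℕ) :
    ∃ P, HasBddDerivs P ∧ iteratedDeriv k g = P * g := by
  induction k with
  | zero => exact ⟨fun _ => 1, .const 1, by ext; simp⟩
  | succ k ih =>
    obtain ⟨P, hP, h⟩ := ih
    refine ⟨_root_.deriv P + P * K', hP.deriv.add (hP.mul hK), ?_⟩
    rw [iteratedDeriv_succ, h]
    ext x
    have h1 : HasDerivAt P (_root_.deriv P x) x :=
      (hP.1.differentiable (by simp)).differentiableAt.hasDerivAt
    rw [(h1.mul (hd x)).deriv]
    simp only [Pi.mul_apply, Pi.add_apply]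
    ring

/-! ### Derivatives of the exponent -/

theorem exponent_base_re (b θ : ℝ) : (-2 * Complex.I * θ + b ^ 2 : ℂ).re = b ^ 2 ∧
    (-2 * Complex.I * θ + b ^ 2 : ℂ).im = -2 * θ := by
  have : (-2 * Complex.I * θ + b ^ 2 : ℂ) =
    ((b ^ 2 : ℝ) : ℂ) + ((-2 * θ : ℝ) : ℂ) * Complex.I := by
    push_cast; ring
  rw [this, Complex.add_re, Complex.add_im, Complex.ofReal_re, Complex.re_ofReal_mul, Complex.I_re,
    Complex.ofReal_im, Complex.im_ofReal_mul, Complex.I_im]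
  simp

/-- The `k`-th derivative of `igExponent`, up to the constant `ab` for `k = 0`. -/
noncomputable def igExponentDeriv (a b : ℝ) (k : ℕ) (θ : ℝ) : ℂ :=
  -a * (∏ j ∈ Finset.range k, (((2⁻¹ - j : ℝ) : ℂ) * (-2 * Complex.I))) *
    (-2 * Complex.I * θ + b ^ 2) ^ ((2⁻¹ - k : ℝ) : ℂ)

theorem igExponent_eq (a b θ : ℝ) : igExponent a b θ = igExponentDeriv a b 0 θ + a * b := by
  simp [igExponent, igExponentDeriv, Complex.sqrt]
  ring

theorem hasDerivAt_igExponentDeriv (a : ℝ) {b : ℝ} (hb : 0 < b) (k : ℕ) (θ : ℝ) :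
    HasDerivAt (igExponentDeriv a b k) (igExponentDeriv a b (k + 1) θ) θ := by
  have hs : (-2 * Complex.I * θ + b ^ 2 : ℂ) ∈ Complex.slitPlane := by
    left; rw [(exponent_base_re b θ).1]; positivity
  have h1 : HasDerivAt (fun θ : ℝ => (-2 * Complex.I * θ + b ^ 2 : ℂ)) (-2 * Complex.I) θ := by
    have := ((Complex.ofRealCLM.hasDerivAt (x := θ)).const_mul (-2 * Complex.I)).add_const
      ((b : ℂ) ^ 2)
    simpa using this
  have h2 := (Complex.hasStrictDerivAt_cpow_const (c := ((2⁻¹ - k : ℝ) : ℂ)) hs).hasDerivAt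
    |>.comp_of_eq θ h1 rfl
  have h3 := h2.const_mul
    (-a * (∏ j ∈ Finset.range k, (((2⁻¹ - j : ℝ) : ℂ) * (-2 * Complex.I))))
  refine h3.congr_deriv ?_
  rw [igExponentDeriv, Finset.prod_range_succ]
  have : (((2⁻¹ - k : ℝ) : ℂ) - 1) = ((2⁻¹ - ((k + 1 : ℕ) : ℝ) : ℝ) : ℂ) := by push_cast; ring
  rw [this]
  ring

/-- The exponent `1/2 - k` is negative and the base has real part `b²`, so its modulus stays away
from zero. For `k = 0` the function grows like a square root, which is why only derivatives of the
exponents `K₁`, `K₂` are claimed bounded. -/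
theorem norm_igExponentDeriv_le (a : ℝ) {b : ℝ} (hb : 0 < b) {k : ℕ} (hk : 1 ≤ k) :
    ∃ C : ℝ, ∀ θ, ‖igExponentDeriv a b k θ‖ ≤ C := by
  refine ⟨‖(-a * (∏ j ∈ Finset.range k, (((2⁻¹ - j : ℝ) : ℂ) * (-2 * Complex.I))) : ℂ)‖ *
    (b ^ 2) ^ (2⁻¹ - k : ℝ), fun θ => ?_⟩
  rw [igExponentDeriv, norm_mul, Complex.norm_cpow_real]
  refine mul_le_mul_of_nonneg_left ?_ (norm_nonneg _)
  refine Real.rpow_le_rpow_of_nonpos (by positivity) ?_ ?_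
  · calc b ^ 2 = (-2 * Complex.I * θ + b ^ 2 : ℂ).re := (exponent_base_re b θ).1.symm
      _ ≤ _ := (le_abs_self _).trans (Complex.abs_re_le_norm _)
  · have : (1 : ℝ) ≤ k := by exact_mod_cast hk
    norm_num; linarith

theorem hasDerivAt_integral_weighted {w : ℝ → ℝ} (hw : Continuous w) {h h' : ℝ → ℂ} {C : ℝ}
    (hd : ∀ x, HasDerivAt h (h' x) x) (hc : Continuous h') (hb : ∀ x, ‖h' x‖ ≤ C)
    (k : ℕ) (τ x : ℝ) :
    HasDerivAt (fun x : ℝ => ∫ s in (0 : ℝ)..τ, (w s : ℂ) ^ k * h (x * w s))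
      (∫ s in (0 : ℝ)..τ, (w s : ℂ) ^ (k + 1) * h' (x * w s)) x := by
  have hh : Continuous h := continuous_iff_continuousAt.2 fun x => (hd x).continuousAt
  refine (intervalIntegral.hasDerivAt_integral_of_dominated_loc_of_deriv_le
    (F := fun (x : ℝ) (s : ℝ) => (w s : ℂ) ^ k * h (x * w s))
    (F' := fun (x : ℝ) (s : ℝ) => (w s : ℂ) ^ (k + 1) * h' (x * w s)) (s := Set.univ)
    (bound := fun s => |w s| ^ (k + 1) * C) univ_mem ?_ ?_ ?_ ?_ ?_ ?_).2
  · refine .of_forall fun x => Continuous.aestronglyMeasurable ?_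
    fun_prop
  · exact Continuous.intervalIntegrable (by fun_prop) _ _
  · exact Continuous.aestronglyMeasurable (by fun_prop)
  · refine .of_forall fun s _ x _ => ?_
    rw [norm_mul, norm_pow, Complex.norm_real, Real.norm_eq_abs]
    exact mul_le_mul_of_nonneg_left (hb _) (by positivity)
  · exact Continuous.intervalIntegrable (by fun_prop) _ _
  · refine .of_forall fun s _ x _ => ?_
    have h1 : HasDerivAt (fun x : ℝ => x * w s) (w s) x := by
      simpa using (hasDerivAt_id x).mul_const (w s)
    have h2 := ((hd (x * w s)).scomp x h1).const_mul ((w s : ℂ) ^ k)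
    refine h2.congr_deriv ?_
    rw [Complex.real_smul]; ring

theorem continuous_igExponentDeriv (a : ℝ) {b : ℝ} (hb : 0 < b) (k : ℕ) :
    Continuous (igExponentDeriv a b k) :=
  continuous_iff_continuousAt.2 fun x => (hasDerivAt_igExponentDeriv a hb k x).continuousAt

theorem continuous_igExponent (a : ℝ) {b : ℝ} (hb : 0 < b) : Continuous (igExponent a b) := by
  rw [funext (igExponent_eq a b)]
  exact (continuous_igExponentDeriv a hb 0).add continuous_const

/-- In the integral form `x` enters only through `Ψ(x w(s))` with `w` bounded on the range of
integration, so each differentiation brings down a factor `w(s)` and one derivative of `Ψ`. -/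
theorem exists_hasDerivAt_igInt (p : FactorParams) (t c : ℝ) :
    ∃ D, HasBddDerivs D ∧ ∀ x, HasDerivAt (fun x : ℝ => igInt p t (x * c)) (D x) x := by
  set w : ℝ → ℝ := fun s => c / p.lam * (1 - Real.exp (-s)) with hw
  have hwc : Continuous w := by fun_prop
  set J : ℕ → ℝ → ℂ := fun k x => ∫ s in (0 : ℝ)..(p.lam * t),
    (w s : ℂ) ^ k * igExponentDeriv p.a p.b k (x * w s) with hJ
  have hJd : ∀ k x, HasDerivAt (J k) (J (k + 1) x) x := by
    intro k x
    obtain ⟨C, hC⟩ := norm_igExponentDeriv_le p.a p.b_pos (k := k + 1) (by omega)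
    exact hasDerivAt_integral_weighted hwc (hasDerivAt_igExponentDeriv p.a p.b_pos k)
      (continuous_igExponentDeriv p.a p.b_pos _) hC k _ x
  refine ⟨J 1, HasBddDerivs.of_chain (h := fun k => J (k + 1)) (fun k x => hJd (k + 1) x) ?_, ?_⟩
  · intro k
    obtain ⟨C, hC⟩ := norm_igExponentDeriv_le p.a p.b_pos (k := k + 1) (by omega)
    refine ⟨|∫ s in (0 : ℝ)..(p.lam * t), |w s| ^ (k + 1) * C|, fun x => ?_⟩
    refine intervalIntegral.norm_integral_le_abs_of_norm_le (.of_forall fun s => ?_)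
      (Continuous.intervalIntegrable (by fun_prop) _ _)
    rw [norm_mul, norm_pow, Complex.norm_real, Real.norm_eq_abs]
    exact mul_le_mul_of_nonneg_left (hC _) (by positivity)
  · intro x
    have : (fun x : ℝ => igInt p t (x * c)) =
        fun x => J 0 x + ∫ s in (0 : ℝ)..(p.lam * t), (p.a * p.b : ℂ) := by
      ext x
      rw [igInt_eq_integral, hJ, ← intervalIntegral.integral_add]
      · refine intervalIntegral.integral_congr fun s _ => ?_
        simp only [hw, pow_zero, one_mul]
        rw [igExponent_eq]
        congr 2; ring
      · have := continuous_igExponentDeriv p.a p.b_pos 0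
        exact Continuous.intervalIntegrable (by fun_prop) _ _
      · exact Continuous.intervalIntegrable (by fun_prop) _ _
    rw [this]
    exact (hJd 0 x).add_const _

/-! ### The exponents `K₁` and `K₂` -/

theorem loading_smul (A : Matrix (Fin 2) (Fin 2) ℝ) (x : ℝ) (l : Fin 2) :
    loading A (x • matM) l = x * loading A matM l := by
  simp [loading, Matrix.trace_smul]

theorem exists_hasDerivAt_sum (p : Fin 2 → FactorParams) (t : ℝ) (c : Fin 2 → ℝ) :
    ∃ D, HasBddDerivs D ∧ ∀ x : ℝ, HasDerivAt (fun x : ℝ =>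
      Complex.I * ∑ l, ((x * c l * (p l).lam⁻¹ * (1 - Real.exp (-(p l).lam * t)) * (p l).x0 : ℝ) : ℂ)
        + ∑ l, igInt (p l) t (x * c l)) (D x) x := by
  choose D hD hd using fun l => exists_hasDerivAt_igInt (p l) t (c l)
  set m : ℂ := Complex.I *
    ∑ l, ((c l * (p l).lam⁻¹ * (1 - Real.exp (-(p l).lam * t)) * (p l).x0 : ℝ) : ℂ) with hm
  refine ⟨(fun _ => m) + (D 0 + D 1), (HasBddDerivs.const m).add ((hD 0).add (hD 1)), fun x => ?_⟩
  have h1 : HasDerivAt (fun x : ℝ => (x : ℂ) * m) m x := by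
    simpa using (Complex.ofRealCLM.hasDerivAt (x := x)).mul_const m
  refine (h1.add ((hd 0 x).add (hd 1 x))).congr_of_eventuallyEq (.of_forall fun x => ?_)
  simp only [hm, Fin.sum_univ_two, Pi.add_apply]
  push_cast
  ring

theorem exists_hasDerivAt_K1 (pF : Fin 2 → FactorParams) (T : ℝ) :
    ∃ D, HasBddDerivs D ∧ ∀ x : ℝ, HasDerivAt (fun x : ℝ => K1 pF T (x • matM)) (D x) x := by
  obtain ⟨D, hD, hd⟩ := exists_hasDerivAt_sum pF T (fun _ => 1)
  refine ⟨D, hD, fun x => (hd x).congr_of_eventuallyEq (.of_forall fun x => ?_)⟩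
  simp [K1, matM, Fin.sum_univ_two]

theorem exists_hasDerivAt_K2 (pV : Fin 2 → FactorParams) (A : Matrix (Fin 2) (Fin 2) ℝ) (T : ℝ) :
    ∃ D, HasBddDerivs D ∧ ∀ x : ℝ, HasDerivAt (fun x : ℝ => K2 pV A T (x • matM)) (D x) x := by
  obtain ⟨D, hD, hd⟩ := exists_hasDerivAt_sum pV T (loading A matM)
  refine ⟨D, hD, fun x => (hd x).congr_of_eventuallyEq (.of_forall fun x => ?_)⟩
  simp only [K2, loading_smul]

/-! ### Decay of `g` -/

/-- The real part of `√z` is `√((|z| + Re z)/2)`; here `Re z = b²`, while `|z| ≥ b²` gives the first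
bound and `|z| ≥ 2|θ|` the second. -/
theorem igExponent_re_le {a : ℝ} (ha : 0 < a) {b : ℝ} (hb : 0 < b) (θ : ℝ) :
    (igExponent a b θ).re ≤ 0 ∧ (igExponent a b θ).re ≤ a * b - a * √|θ| := by
  have h1 : (igExponent a b θ).re =
      -a * ((Complex.sqrt (-2 * Complex.I * θ + b ^ 2)).re - b) := by
    rw [igExponent, ← Complex.ofReal_neg, Complex.re_ofReal_mul]; simp
  have h2 : (Complex.sqrt (-2 * Complex.I * θ + b ^ 2)).re =
      √((‖(-2 * Complex.I * θ + b ^ 2 : ℂ)‖ + b ^ 2) / 2) := by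
    rw [Complex.sqrt, Complex.cpow_inv_two_re, (exponent_base_re b θ).1]
  have h3 := Complex.abs_re_le_norm (-2 * Complex.I * θ + b ^ 2 : ℂ)
  have h4 := Complex.abs_im_le_norm (-2 * Complex.I * θ + b ^ 2 : ℂ)
  rw [(exponent_base_re b θ).1, abs_of_pos (by positivity)] at h3
  rw [(exponent_base_re b θ).2, abs_mul] at h4
  norm_num at h4
  have h5 : b ≤ √((‖(-2 * Complex.I * θ + b ^ 2 : ℂ)‖ + b ^ 2) / 2) :=
    Real.le_sqrt_of_sq_le (by linarith)
  have h6 : √|θ| ≤ √((‖(-2 * Complex.I * θ + b ^ 2 : ℂ)‖ + b ^ 2) / 2) := by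
    refine Real.sqrt_le_sqrt ?_
    have := sq_nonneg b
    norm_num; linarith
  rw [h1, h2]
  constructor
  · nlinarith
  · nlinarith

theorem igInt_re_eq (p : FactorParams) (t θ : ℝ) :
    (igInt p t θ).re = ∫ s in (0 : ℝ)..(p.lam * t),
      (igExponent p.a p.b (θ / p.lam * (1 - Real.exp (-s)))).re := by
  have := continuous_igExponent p.a p.b_pos
  rw [igInt_eq_integral]
  exact (Complex.reCLM.intervalIntegral_comp_comm
    (Continuous.intervalIntegrable (by fun_prop) _ _)).symm

theorem igInt_re_nonpos (p : FactorParams) {t : ℝ} (ht : 0 < t) (θ : ℝ) :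
    (igInt p t θ).re ≤ 0 := by
  rw [igInt_re_eq]
  have h := intervalIntegral.integral_nonneg (μ := volume)
    (f := fun s => -(igExponent p.a p.b (θ / p.lam * (1 - Real.exp (-s)))).re)
    (mul_pos p.lam_pos ht).le
    (fun s _ => neg_nonneg.2 (igExponent_re_le p.a_pos p.b_pos _).1)
  rw [intervalIntegral.integral_neg] at h
  linarith

theorem exists_igInt_re_le (p : FactorParams) {t : ℝ} (ht : 0 < t) :
    ∃ C c : ℝ, 0 < c ∧ ∀ θ : ℝ, (igInt p t θ).re ≤ C - c * √|θ| := by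
  have hl := p.lam_pos
  have hτ := mul_pos p.lam_pos ht
  have hcont := continuous_igExponent p.a p.b_pos
  set κ : ℝ := ∫ s in (0 : ℝ)..(p.lam * t), √((1 - Real.exp (-s)) / p.lam) with hκ
  have hκ0 : 0 < κ := by
    refine intervalIntegral.intervalIntegral_pos_of_pos_on
      (Continuous.intervalIntegrable (by fun_prop) _ _) (fun s hs => ?_) hτ
    have : Real.exp (-s) < 1 := Real.exp_lt_one_iff.2 (by linarith [hs.1])
    have : 0 < 1 - Real.exp (-s) := by linarith
    positivity
  refine ⟨p.a * p.b * (p.lam * t), p.a * κ, mul_pos p.a_pos hκ0, fun θ => ?_⟩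
  have e : p.a * p.b * (p.lam * t) - p.a * κ * √|θ| =
      ∫ s in (0 : ℝ)..(p.lam * t),
        (p.a * p.b - p.a * √|θ| * √((1 - Real.exp (-s)) / p.lam)) := by
    rw [intervalIntegral.integral_sub (Continuous.intervalIntegrable (by fun_prop) _ _)
      (Continuous.intervalIntegrable (by fun_prop) _ _), intervalIntegral.integral_const_mul (p.a * √|θ|), ← hκ]
    simp
    ring
  rw [igInt_re_eq, e]
  refine intervalIntegral.integral_mono_on hτ.le (Continuous.intervalIntegrable
    (Complex.continuous_re.comp (hcont.comp (by fun_prop))) _ _)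
    (Continuous.intervalIntegrable (by fun_prop) _ _) fun s hs => ?_
  refine (igExponent_re_le p.a_pos p.b_pos _).2.trans (le_of_eq ?_)
  have : Real.exp (-s) ≤ 1 := Real.exp_le_one_iff.2 (by linarith [hs.1])
  have h0 : 0 ≤ (1 - Real.exp (-s)) / p.lam := div_nonneg (by linarith) hl.le
  rw [mul_assoc p.a, ← Real.sqrt_mul (abs_nonneg θ)]
  congr 3
  rw [div_mul_eq_mul_div, mul_div_assoc, abs_mul, abs_of_nonneg h0]

/-- One factor suffices: the first `F` enters with coefficient `1` whatever `A` is, the other three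
contribute nonpositive real parts, and the initial values contribute only a phase. -/
theorem exists_norm_g_le (pF pV : Fin 2 → FactorParams) (A : Matrix (Fin 2) (Fin 2) ℝ) {T : ℝ}
    (hT : 0 < T) : ∃ C : ℝ, ∀ x, ‖g pF pV A T x‖ ≤ C * (1 + x ^ 2)⁻¹ := by
  obtain ⟨C, c, hc, h⟩ := exists_igInt_re_le (pF 0) hT
  -- From `exp r ≥ r⁴/4!` at `r = c√|x|`, where `r⁴ = c⁴x²`; the summand `1` uses `exp r ≥ 1`.
  refine ⟨Real.exp C * (1 + 24 / c ^ 4), fun x => ?_⟩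
  have h1 : (K1 pF T (x • matM)).re ≤ C - c * √|x| := by
    have h2 := igInt_re_nonpos (pF 1) hT x
    have h3 := h x
    rw [K1, ← Complex.ofReal_sum, Complex.add_re, mul_comm, Complex.re_ofReal_mul, Complex.I_re]
    simp only [Fin.sum_univ_two, Complex.add_re]
    simp only [matM]
    simp
    linarith
  have h2 : (K2 pV A T (x • matM)).re ≤ 0 := by
    rw [K2, ← Complex.ofReal_sum, Complex.add_re, mul_comm, Complex.re_ofReal_mul, Complex.I_re]
    simp only [Fin.sum_univ_two, Complex.add_re]
    have := igInt_re_nonpos (pV 0) hT (loading A (x • matM) 0)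
    have := igInt_re_nonpos (pV 1) hT (loading A (x • matM) 1)
    linarith
  rw [g, Complex.norm_exp, Complex.add_re]
  calc Real.exp ((K1 pF T (x • matM)).re + (K2 pV A T (x • matM)).re)
      ≤ Real.exp (C - c * √|x|) := Real.exp_le_exp.2 (by linarith)
    _ = Real.exp C * (Real.exp (c * √|x|))⁻¹ := by rw [Real.exp_sub, div_eq_mul_inv]
    _ ≤ Real.exp C * ((1 + 24 / c ^ 4) * (1 + x ^ 2)⁻¹) := by
      refine mul_le_mul_of_nonneg_left ?_ (Real.exp_pos _).le
      have h3 := Real.pow_div_factorial_le_exp (c * √|x|) (by positivity) 4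
      have h4 : (c * √|x|) ^ 4 = c ^ 4 * x ^ 2 := by
        rw [mul_pow, show (4 : ℕ) = 2 * 2 by norm_num, pow_mul (√|x|), Real.sq_sqrt (abs_nonneg x),
          sq_abs]
      have h5 : 1 ≤ Real.exp (c * √|x|) := Real.one_le_exp (by positivity)
      rw [h4] at h3
      have h6 : x ^ 2 ≤ 24 / c ^ 4 * Real.exp (c * √|x|) := by
        rw [div_mul_eq_mul_div, le_div_iff₀ (by positivity)]
        norm_num [Nat.factorial] at h3
        linarith
      rw [← div_eq_mul_inv, le_div_iff₀ (by positivity), inv_mul_le_iff₀ (Real.exp_pos _)]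
      nlinarith
    _ = _ := by ring

/-! ### Inversion of integrable characteristic functions -/

open scoped FourierTransform SchwartzMap RealInnerProductSpace

theorem integrable_comp_two_pi {φ : ℝ → ℂ} (hφ : Integrable φ) :
    Integrable (fun x : ℝ => φ (2 * Real.pi * x)) :=
  hφ.comp_mul_left' (by positivity)

/-- The exchange formula for Fourier integrals, used twice: it moves the transform from `μ` to `𝓕
ψ`, where Fourier inversion for Schwartz functions gives back `ψ`, and then from `ψ` to the
characteristic function. -/
theorem integral_schwartz_eq (μ : Measure ℝ) [IsFiniteMeasure μ] (hφ : Integrable (charFun μ))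
    (ψ : 𝓢(ℝ, ℂ)) :
    ∫ v, ψ v ∂μ = ∫ v, ψ v * 𝓕 (fun x : ℝ => charFun μ (2 * Real.pi * x)) v := by
  have hG := integrable_comp_two_pi hφ
  -- The negated pairing makes the transform of `μ` its characteristic function at `2πξ` rather than
  -- `-2πξ`.
  have h1 := VectorFourier.integral_fourierIntegral_smul_eq_flip (L := -innerₗ ℝ)
    (f := fun _ => (1 : ℂ)) (g := fun x => (𝓕 ψ) x) (μ := μ) (ν := volume)
    Real.continuous_fourierChar (by
      simp only [LinearMap.neg_apply, innerₗ_apply_apply]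
      fun_prop)
    (integrable_const 1) (𝓕 ψ).integrable
  have h2 := VectorFourier.integral_fourierIntegral_smul_eq_flip (L := innerₗ ℝ)
    (f := fun x => ψ x) (g := fun x : ℝ => charFun μ (2 * Real.pi * x)) (μ := volume) (ν := volume)
    Real.continuous_fourierChar continuous_inner ψ.integrable hG
  have e1 : ∀ ξ : ℝ, VectorFourier.fourierIntegral Real.fourierChar μ (-innerₗ ℝ)
      (fun _ => (1 : ℂ)) ξ = charFun μ (2 * Real.pi * ξ) := by
    intro ξ
    rw [VectorFourier.fourierIntegral, charFun_apply_real]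
    refine integral_congr_ae (.of_forall fun x => ?_)
    simp only [Circle.smul_def, Real.fourierChar_apply]
    simp
    congr 1
    ring
  have e2 : ∀ x : ℝ, VectorFourier.fourierIntegral Real.fourierChar volume (-innerₗ ℝ).flip
      (fun x => (𝓕 ψ) x) x = ψ x := by
    intro x
    have h3 : (𝓕⁻ (𝓕 ψ)) x = ψ x := by rw [FourierTransform.fourierInv_fourier_eq]
    rw [← h3, SchwartzMap.fourierInv_coe, Real.fourierInv_eq, VectorFourier.fourierIntegral]
    refine integral_congr_ae (.of_forall fun y => ?_)
    simp [mul_comm]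
  simp_rw [e1, e2, one_smul] at h1
  rw [← h1]
  have h3 : ∫ ξ : ℝ, charFun μ (2 * Real.pi * ξ) • (𝓕 ψ) ξ =
      ∫ ξ, (VectorFourier.fourierIntegral Real.fourierChar volume (innerₗ ℝ) (fun x => ψ x) ξ) •
        charFun μ (2 * Real.pi * ξ) := by
    refine integral_congr_ae (.of_forall fun y => ?_)
    simp only [smul_eq_mul]
    rw [mul_comm, SchwartzMap.fourier_coe]
    rfl
  rw [h3, h2]
  refine integral_congr_ae (.of_forall fun y => ?_)
  simp only [smul_eq_mul]
  rw [flip_innerₗ]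
  rfl

/-- Smooth bumps decreasing to the indicator function of `[a, b]`. -/
noncomputable def bump (a b : ℝ) (hab : a ≤ b) (n : ℕ) : ContDiffBump ((a + b) / 2) where
  rIn := (b - a) / 2 + 1 / (n + 2)
  rOut := (b - a) / 2 + 1 / (n + 1)
  rIn_pos := by have : (0 : ℝ) < 1 / (n + 2) := by positivity
                linarith
  rIn_lt_rOut := by
    have : (1 : ℝ) / (n + 2) < 1 / (n + 1) := by gcongr; norm_num
    linarith

theorem mem_closedBall_midpoint {a b r x : ℝ} :
    x ∈ Metric.closedBall ((a + b) / 2) ((b - a) / 2 + r) ↔ x ∈ Set.Icc (a - r) (b + r) := by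
  rw [Real.closedBall_eq_Icc]
  simp only [Set.mem_Icc]
  constructor <;> rintro ⟨h1, h2⟩ <;> constructor <;> linarith

theorem bump_eq_zero {a b : ℝ} (hab : a ≤ b) (n : ℕ) {x : ℝ}
    (hx : x ∉ Set.Icc (a - 1 / (n + 1)) (b + 1 / (n + 1))) : bump a b hab n x = 0 := by
  refine ContDiffBump.zero_of_le_dist _ ?_
  rw [← mem_closedBall_midpoint, Metric.mem_closedBall, not_le] at hx
  exact hx.le

theorem bump_eq_one {a b : ℝ} (hab : a ≤ b) (n : ℕ) {x : ℝ} (hx : x ∈ Set.Icc a b) :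
    bump a b hab n x = 1 := by
  refine ContDiffBump.one_of_mem_closedBall _ ?_
  have : (0 : ℝ) < 1 / (n + 2) := by positivity
  exact mem_closedBall_midpoint.2 ⟨by linarith [hx.1], by linarith [hx.2]⟩

theorem tendsto_bump {a b : ℝ} (hab : a ≤ b) (x : ℝ) :
    Tendsto (fun n => bump a b hab n x) atTop (𝓝 ((Set.Icc a b).indicator 1 x)) := by
  by_cases hx : x ∈ Set.Icc a b
  · rw [Set.indicator_of_mem hx]
    exact tendsto_const_nhds.congr fun n => (bump_eq_one hab n hx).symm
  · rw [Set.indicator_of_notMem hx]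
    refine tendsto_const_nhds.congr' ?_
    have hm : 0 < max (a - x) (x - b) := by
      by_contra! h
      exact hx ⟨by linarith [le_max_left (a - x) (x - b)], by linarith [le_max_right (a - x) (x - b)]⟩
    filter_upwards [tendsto_one_div_add_atTop_nhds_zero_nat.eventually_lt_const hm] with n hn
    refine (bump_eq_zero hab n fun h => ?_).symm
    rcases lt_max_iff.1 hn with h1 | h1
    · linarith [h.1]
    · linarith [h.2]

theorem norm_exp_I_mul_real (x y : ℝ) : ‖Complex.exp (Complex.I * x * y)‖ = 1 := by
  rw [show (Complex.I * x * y : ℂ) = ((x * y : ℝ) : ℂ) * Complex.I by push_cast; ring]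
  exact Complex.norm_exp_ofReal_mul_I _

/-- Smooth bumps times the exponential are Schwartz functions, and they converge pointwise to the
cut-off exponential at every point, the endpoints included. Both sides therefore pass to the limit
without first excluding atoms of `μ`. -/
theorem setIntegral_eq_setIntegral_fourier (μ : Measure ℝ) [IsFiniteMeasure μ]
    (hφ : Integrable (charFun μ)) {a b : ℝ} (hab : a ≤ b) (u : ℝ) :
    ∫ v in Set.Icc a b, Complex.exp (Complex.I * u * v) ∂μ =
      ∫ v in Set.Icc a b, Complex.exp (Complex.I * u * v) *
        𝓕 (fun x : ℝ => charFun μ (2 * Real.pi * x)) v := by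
  set H : ℝ → ℂ := 𝓕 (fun x : ℝ => charFun μ (2 * Real.pi * x)) with hH
  have hHc : Continuous H :=
    VectorFourier.fourierIntegral_continuous Real.continuous_fourierChar
      (L := innerₗ ℝ) continuous_inner (integrable_comp_two_pi hφ)
  set e : ℝ → ℂ := fun v => Complex.exp (Complex.I * u * v) with he
  have hec : Continuous e := by fun_prop
  have hes : ContDiff ℝ (⊤ : ℕ∞) e :=
    (contDiff_const.mul Complex.ofRealCLM.contDiff).cexp
  have hen : ∀ v, ‖e v‖ = 1 := norm_exp_I_mul_real u
  have key : ∀ n, ∫ v, (bump a b hab n v : ℂ) * e v ∂μ =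
      ∫ v, (bump a b hab n v : ℂ) * e v * H v := by
    intro n
    have hc : HasCompactSupport (fun v => (bump a b hab n v : ℂ) * e v) :=
      ((bump a b hab n).hasCompactSupport.comp_left (g := fun x : ℝ => (x : ℂ)) rfl).mul_right
    have hs : ContDiff ℝ (⊤ : ℕ∞) (fun v => (bump a b hab n v : ℂ) * e v) :=
      (Complex.ofRealCLM.contDiff.comp (bump a b hab n).contDiff).mul hes
    exact integral_schwartz_eq μ hφ (hc.toSchwartzMap hs)
  have lim : ∀ v, Tendsto (fun n => (bump a b hab n v : ℂ) * e v) atTop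
      (𝓝 ((Set.Icc a b).indicator e v)) := by
    intro v
    have h1 := ((Complex.continuous_ofReal.tendsto _).comp (tendsto_bump hab v)).mul_const (e v)
    have h2 : (Set.Icc a b).indicator e v =
        (((Set.Icc a b).indicator (1 : ℝ → ℝ) v : ℝ) : ℂ) * e v := by
      by_cases hv : v ∈ Set.Icc a b
      · rw [Set.indicator_of_mem hv, Set.indicator_of_mem hv]; simp
      · rw [Set.indicator_of_notMem hv, Set.indicator_of_notMem hv]; simp
    rw [h2]
    exact h1
  have hbd : ∀ n v, ‖(bump a b hab n v : ℂ)‖ ≤ 1 := by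
    intro n v
    rw [Complex.norm_real, Real.norm_eq_abs, abs_of_nonneg (bump a b hab n).nonneg]
    exact (bump a b hab n).le_one
  have hbc : ∀ n, Continuous fun v => (bump a b hab n v : ℂ) := fun n =>
    Complex.continuous_ofReal.comp (bump a b hab n).continuous
  have l1 : Tendsto (fun n => ∫ v, (bump a b hab n v : ℂ) * e v ∂μ) atTop
      (𝓝 (∫ v, (Set.Icc a b).indicator e v ∂μ)) := by
    refine tendsto_integral_of_dominated_convergence (fun _ => 1)
      (fun n => ((hbc n).mul hec).aestronglyMeasurable) (integrable_const _) (fun n => ?_)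
      (.of_forall lim)
    refine .of_forall fun v => ?_
    rw [norm_mul, hen, mul_one]
    exact hbd n v
  have l2 : Tendsto (fun n => ∫ v, (bump a b hab n v : ℂ) * e v * H v) atTop
      (𝓝 (∫ v, (Set.Icc a b).indicator e v * H v)) := by
    -- `H` is only known to be continuous, so the domination uses that all bumps vanish outside `[a
    -- - 1, b + 1]`.
    refine tendsto_integral_of_dominated_convergence
      (fun v => (Set.Icc (a - 1) (b + 1)).indicator (fun v => ‖H v‖) v)
      (fun n => (((hbc n).mul hec).mul hHc).aestronglyMeasurable) ?_ (fun n => ?_)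
      (.of_forall fun v => (lim v).mul_const _)
    · exact (integrable_indicator_iff measurableSet_Icc).2
        hHc.norm.continuousOn.integrableOn_Icc
    · refine .of_forall fun v => ?_
      by_cases hv : v ∈ Set.Icc (a - 1) (b + 1)
      · rw [Set.indicator_of_mem hv, norm_mul, norm_mul, hen, mul_one]
        exact mul_le_of_le_one_left (norm_nonneg _) (hbd n v)
      · rw [Set.indicator_of_notMem hv, bump_eq_zero hab n]
        · simp
        · have : (1 : ℝ) / (n + 1) ≤ 1 := by
            rw [div_le_one (by positivity)]; linarith [(Nat.cast_nonneg n : (0 : ℝ) ≤ n)]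
          exact fun h => hv ⟨by linarith [h.1], by linarith [h.2]⟩
  have := tendsto_nhds_unique (l1.congr key) l2
  rw [← integral_indicator measurableSet_Icc, ← integral_indicator measurableSet_Icc, this]
  refine integral_congr_ae (.of_forall fun v => ?_)
  by_cases hv : v ∈ Set.Icc a b <;> simp [hv, he]

/-- This form absorbs the case `y = 0`; continuity of `f` and the bound `|b - a|` follow from it,
and it is what Fubini acts on. -/
theorem f_eq_integral (y a b : ℝ) :
    f y a b = Complex.I * ∫ v in a..b, Complex.exp (Complex.I * y * v) := by
  by_cases hy : y = 0
  · simp [f, hy]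
  · have h0 : (Complex.I * y : ℂ) ≠ 0 := mul_ne_zero Complex.I_ne_zero (by exact_mod_cast hy)
    have hy' : (y : ℂ) ≠ 0 := by exact_mod_cast hy
    rw [f, if_neg hy, integral_exp_mul_complex h0]
    have := Complex.I_ne_zero
    field_simp

theorem continuous_f (a b : ℝ) : Continuous fun y => f y a b := by
  simp_rw [f_eq_integral]
  refine continuous_const.mul
    (intervalIntegral.continuous_parametric_intervalIntegral_of_continuous' ?_ a b)
  fun_prop

theorem norm_f_le (y a b : ℝ) : ‖f y a b‖ ≤ |b - a| := by
  rw [f_eq_integral, norm_mul, Complex.norm_I, one_mul]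
  refine (intervalIntegral.norm_integral_le_of_norm_le_const (C := 1) fun v _ => ?_).trans
    (by rw [one_mul])
  exact (norm_exp_I_mul_real y v).le

theorem integrable_f_mul {h : ℝ → ℂ} (hh : Integrable h) (a b : ℝ) :
    Integrable fun y => f y a b * h y :=
  hh.bdd_mul (continuous_f a b).aestronglyMeasurable (.of_forall fun y => norm_f_le y a b)

theorem fourier_charFun_scaled (μ : Measure ℝ) (v : ℝ) :
    𝓕 (fun x : ℝ => charFun μ (2 * Real.pi * x)) v =
      (2 * Real.pi)⁻¹ * ∫ x : ℝ, Complex.exp (-(Complex.I * v * x)) * charFun μ x := by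
  rw [Real.fourier_eq']
  have h := Measure.integral_comp_mul_left
    (fun x : ℝ => Complex.exp (-(Complex.I * v * x)) * charFun μ x) (2 * Real.pi)
  rw [abs_of_pos (by positivity)] at h
  rw [Complex.real_smul] at h
  push_cast at h ⊢
  rw [← h]
  refine integral_congr_ae (.of_forall fun x => ?_)
  simp only [smul_eq_mul]
  congr 2
  simp
  ring

/-- Inversion formula for measures with integrable characteristic function, constrained to a
compact interval. -/
theorem setIntegral_exp_eq_integral_f (μ : Measure ℝ) [IsFiniteMeasure μ]
    (hφ : Integrable (charFun μ)) {a b : ℝ} (hab : a ≤ b) (u : ℝ) :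
    ∫ v in Set.Icc a b, Complex.exp (Complex.I * u * v) ∂μ =
      -(Complex.I / (2 * Real.pi)) * ∫ y : ℝ, f y a b * charFun μ (u - y) := by
  rw [setIntegral_eq_setIntegral_fourier μ hφ hab u]
  have e1 : ∀ y : ℝ, f y a b * charFun μ (u - y) =
      Complex.I * ∫ v in Set.Icc a b, Complex.exp (Complex.I * y * v) * charFun μ (u - y) := by
    intro y
    rw [f_eq_integral, intervalIntegral.integral_of_le hab, ← integral_Icc_eq_integral_Ioc,
      integral_mul_const, mul_assoc]
  -- The exponential has modulus one, and `[a, b]` has finite measure, so integrability in `y` of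
  -- the characteristic function suffices.
  have hint : Integrable (Function.uncurry fun (y v : ℝ) =>
      Complex.exp (Complex.I * y * v) * charFun μ (u - y))
      (volume.prod (volume.restrict (Set.Icc a b))) := by
    have h1 : Integrable (fun z : ℝ × ℝ => charFun μ (u - z.1) * (1 : ℂ))
        (volume.prod (volume.restrict (Set.Icc a b))) :=
      (hφ.comp_sub_left u).mul_prod (integrable_const (1 : ℂ))
    simp only [mul_one] at h1
    refine h1.bdd_mul (f := fun z : ℝ × ℝ => Complex.exp (Complex.I * z.1 * z.2)) (c := 1)
      (Continuous.aestronglyMeasurable (by fun_prop)) (.of_forall fun z => ?_)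
    exact (norm_exp_I_mul_real _ _).le
  simp_rw [e1]
  rw [integral_const_mul, integral_integral_swap hint, ← integral_const_mul, ← integral_const_mul]
  refine integral_congr_ae (.of_forall fun v => ?_)
  simp only
  rw [fourier_charFun_scaled,
    ← integral_sub_left_eq_self (fun x : ℝ => Complex.exp (-(Complex.I * v * x)) * charFun μ x)
      volume u]
  rw [← integral_const_mul, ← integral_const_mul, ← integral_const_mul, ← integral_const_mul]
  refine integral_congr_ae (.of_forall fun y => ?_)
  simp only
  have : Complex.exp (Complex.I * y * v) = Complex.exp (Complex.I * u * v) *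
      Complex.exp (-(Complex.I * v * ((u - y : ℝ) : ℂ))) := by
    rw [← Complex.exp_add]; congr 1; push_cast; ring
  rw [this]
  push_cast
  linear_combination ((2 * Real.pi : ℂ)⁻¹ * Complex.exp (Complex.I * u * v) *
    Complex.exp (-(Complex.I * v * (u - y))) * charFun μ (u - y)) * Complex.I_sq

/-! ### Derivatives of the inversion integral -/

theorem integrable_of_norm_le_inv_one_add_sq {h : ℝ → ℂ} (hc : Continuous h) {C : ℝ}
    (hb : ∀ x, ‖h x‖ ≤ C * (1 + x ^ 2)⁻¹) : Integrable h :=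
  (integrable_inv_one_add_sq.const_mul C).mono' hc.aestronglyMeasurable (.of_forall hb)

theorem hasDerivAt_integral_f_mul {h h' : ℝ → ℂ} (hd : ∀ x, HasDerivAt h (h' x) x)
    (hc' : Continuous h') {C C' : ℝ} (hb : ∀ x, ‖h x‖ ≤ C * (1 + x ^ 2)⁻¹)
    (hb' : ∀ x, ‖h' x‖ ≤ C' * (1 + x ^ 2)⁻¹) (a b u : ℝ) :
    HasDerivAt (fun u => ∫ y : ℝ, f y a b * h (u - y)) (∫ y : ℝ, f y a b * h' (u - y)) u := by
  have hc : Continuous h := continuous_iff_continuousAt.2 fun x => (hd x).continuousAt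
  have hf := continuous_f a b
  have hC' : 0 ≤ C' := by
    have := (norm_nonneg _).trans (hb' 0)
    simpa using this
  refine (hasDerivAt_integral_of_dominated_loc_of_deriv_le (F := fun u y => f y a b * h (u - y))
    (F' := fun u y => f y a b * h' (u - y)) (Metric.ball_mem_nhds u one_pos)
    (bound := fun y => |b - a| * (C' * (3 * (1 + (u - y) ^ 2)⁻¹))) ?_ ?_ ?_ ?_ ?_ ?_).2
  · exact .of_forall fun x => (hf.mul (by fun_prop)).aestronglyMeasurable
  · exact integrable_f_mul ((integrable_of_norm_le_inv_one_add_sq hc hb).comp_sub_left u) a b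
  · exact (hf.mul (by fun_prop)).aestronglyMeasurable
  · refine .of_forall fun y x hx => ?_
    rw [norm_mul]
    refine mul_le_mul (norm_f_le y a b) ((hb' _).trans ?_) (norm_nonneg _) (abs_nonneg _)
    refine mul_le_mul_of_nonneg_left ?_ hC'
    rw [Metric.mem_ball, Real.dist_eq, abs_lt] at hx
    -- The factor `3`: for `|x - u| < 1`, `1 + (u - y)² ≤ 1 + 2(x - y)² + 2 ≤ 3(1 + (x - y)²)`.
    rw [← div_eq_mul_inv, le_div_iff₀ (by positivity), inv_mul_le_iff₀ (by positivity)]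
    nlinarith [sq_nonneg (2 * (x - y) + (x - u)), sq_nonneg (x - y), sq_nonneg ((x - y) + (x - u))]
  · exact (((integrable_inv_one_add_sq.comp_sub_left u).const_mul 3).const_mul C').const_mul _
  · refine .of_forall fun y x _ => ?_
    exact ((hd (x - y)).comp_sub_const x y).const_mul _

theorem iteratedDeriv_integral_f_mul {h : ℝ → ℂ} (hs : ContDiff ℝ (⊤ : ℕ∞) h)
    (hb : ∀ k, ∃ C : ℝ, ∀ x, ‖iteratedDeriv k h x‖ ≤ C * (1 + x ^ 2)⁻¹) (a b : ℝ) (n : ℕ) :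
    iteratedDeriv n (fun u => ∫ y : ℝ, f y a b * h (u - y)) =
      fun u => ∫ y : ℝ, f y a b * iteratedDeriv n h (u - y) := by
  have hd : ∀ (k : ℕ) (x : ℝ), HasDerivAt (iteratedDeriv k h) (iteratedDeriv (k + 1) h x) x := by
    intro k x
    rw [iteratedDeriv_succ]
    exact (hs.differentiable_iteratedDeriv k (by exact_mod_cast ENat.natCast_lt_top k)).differentiableAt.hasDerivAt
  have := iteratedDeriv_eq_of_chain (h := fun k u => ∫ y : ℝ, f y a b * iteratedDeriv k h (u - y))
    (fun k u => by
      obtain ⟨C, hC⟩ := hb k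
      obtain ⟨C', hC'⟩ := hb (k + 1)
      exact hasDerivAt_integral_f_mul (hd k)
        (hs.continuous_iteratedDeriv (k + 1) (by exact_mod_cast le_top)) hC hC' a b u) n
  simpa using this

/-- `g` is smooth, and it decays quadratically together with all its derivatives. -/
theorem g_regularity (pF pV : Fin 2 → FactorParams) (A : Matrix (Fin 2) (Fin 2) ℝ) {T : ℝ}
    (hT : 0 < T) :
    ContDiff ℝ (⊤ : ℕ∞) (g pF pV A T) ∧
    ∀ k, ∃ C : ℝ, ∀ x, ‖iteratedDeriv k (g pF pV A T) x‖ ≤ C * (1 + x ^ 2)⁻¹ := by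
  obtain ⟨D1, hD1, hd1⟩ := exists_hasDerivAt_K1 pF T
  obtain ⟨D2, hD2, hd2⟩ := exists_hasDerivAt_K2 pV A T
  have hg : ∀ x, HasDerivAt (g pF pV A T) ((D1 + D2) x * g pF pV A T x) x := by
    intro x
    refine ((hd1 x).add (hd2 x)).cexp.congr_deriv ?_
    rw [mul_comm]
    rfl
  refine ⟨((contDiff_of_hasDerivAt hd1 hD1).add (contDiff_of_hasDerivAt hd2 hD2)).cexp,
    fun k => ?_⟩
  obtain ⟨P, hP, h⟩ := exists_iteratedDeriv_eq_mul hg (hD1.add hD2) k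
  obtain ⟨C, hC⟩ := exists_norm_g_le pF pV A hT
  obtain ⟨C', hC'⟩ := hP.2 0
  refine ⟨C' * C, fun x => ?_⟩
  rw [h, Pi.mul_apply, norm_mul, mul_assoc]
  simp only [iteratedDeriv_zero] at hC'
  exact mul_le_mul (hC' x) (hC x) (norm_nonneg _) ((norm_nonneg _).trans (hC' x))

theorem integrable_iteratedDeriv_g (pF pV : Fin 2 → FactorParams) (A : Matrix (Fin 2) (Fin 2) ℝ)
    {T : ℝ} (hT : 0 < T) (k : ℕ) : Integrable (iteratedDeriv k (g pF pV A T)) := by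
  obtain ⟨hs, hb⟩ := g_regularity pF pV A hT
  obtain ⟨C, hC⟩ := hb k
  exact integrable_of_norm_le_inv_one_add_sq
    (hs.continuous_iteratedDeriv k (by exact_mod_cast le_top)) hC

/-- Leibniz' rule for the derivatives of `g`, multiplied by `f`. -/
theorem derivIntegrand_spec (pF pV : Fin 2 → FactorParams) (A : Matrix (Fin 2) (Fin 2) ℝ)
    {T : ℝ} (hT : 0 < T) (a b : ℝ) {n : ℕ} (hn : 1 ≤ n) :
    (∀ j, Integrable (derivIntegrand pF pV A T a b n j)) ∧
    ∀ y, f y a b * iteratedDeriv n (g pF pV A T) (0 - y) =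
      ∑ j ∈ Finset.range n, ((n - 1).choose j : ℂ) * derivIntegrand pF pV A T a b n j y := by
  obtain ⟨D1, hD1, hd1⟩ := exists_hasDerivAt_K1 pF T
  obtain ⟨D2, hD2, hd2⟩ := exists_hasDerivAt_K2 pV A T
  have hs := (g_regularity pF pV A hT).1
  have hg : deriv (g pF pV A T) = (D1 + D2) * g pF pV A T := by
    ext x
    refine HasDerivAt.deriv (((hd1 x).add (hd2 x)).cexp.congr_deriv ?_)
    rw [Pi.mul_apply, mul_comm]
    rfl
  have hK := hD1.add hD2
  have e : ∀ j y, derivIntegrand pF pV A T a b n j y =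
      f y a b * (iteratedDeriv j (D1 + D2) (0 - y) *
        iteratedDeriv (n - 1 - j) (g pF pV A T) (0 - y)) := by
    intro j y
    rw [derivIntegrand, iteratedDeriv_comp_sub_const j.succ (fun x => K1 pF T (x • matM)) y,
      iteratedDeriv_comp_sub_const j.succ (fun x => K2 pV A T (x • matM)) y,
      iteratedDeriv_comp_sub_const _ (g pF pV A T) y, iteratedDeriv_succ', iteratedDeriv_succ',
      funext fun x => (hd1 x).deriv, funext fun x => (hd2 x).deriv,
      iteratedDeriv_add (hD1.1.of_le (by exact_mod_cast le_top)).contDiffAt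
        (hD2.1.of_le (by exact_mod_cast le_top)).contDiffAt, Nat.sub_right_comm]
    ring
  constructor
  · intro j
    rw [funext (e j)]
    obtain ⟨C, hC⟩ := hK.2 j
    refine integrable_f_mul (h := fun y => iteratedDeriv j (D1 + D2) (0 - y) *
        iteratedDeriv (n - 1 - j) (g pF pV A T) (0 - y)) ?_ a b
    refine ((integrable_iteratedDeriv_g pF pV A hT _).comp_sub_left 0).bdd_mul (c := C) ?_
      (.of_forall fun y => hC _)
    exact ((hK.1.continuous_iteratedDeriv j (by exact_mod_cast le_top)).comp
      (by fun_prop)).aestronglyMeasurable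
  · intro y
    obtain ⟨m, rfl⟩ : ∃ m, n = m + 1 := ⟨n - 1, by omega⟩
    rw [iteratedDeriv_succ', hg, iteratedDeriv_mul (hK.1.of_le (by exact_mod_cast le_top)).contDiffAt
      (hs.of_le (by exact_mod_cast le_top)).contDiffAt, Finset.mul_sum]
    refine Finset.sum_congr rfl fun j _ => ?_
    rw [e, Nat.add_sub_cancel]
    ring

/-! ### Constrained characteristic functions -/

theorem charFun_map_eq {Ω : Type*} [MeasurableSpace Ω] (Q : Measure Ω) {X : Ω → ℝ}
    (hX : AEMeasurable X Q) (x : ℝ) :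
    charFun (Q.map X) x = ∫ ω, Complex.exp (Complex.I * x * X ω) ∂Q := by
  rw [charFun_apply_real, integral_map hX (Continuous.aestronglyMeasurable (by fun_prop))]
  refine integral_congr_ae (.of_forall fun ω => ?_)
  simp only
  congr 1
  ring

theorem constrainedCharFun_eq_setIntegral {Ω : Type*} [MeasurableSpace Ω] (Q : Measure Ω) {X : Ω → ℝ}
    (hX : AEMeasurable X Q) (a b u : ℝ) :
    constrainedCharFun Q X a b u =
      ∫ v in Set.Icc a b, Complex.exp (Complex.I * u * v) ∂(Q.map X) := by
  have hc : Continuous fun v : ℝ => Complex.exp (Complex.I * u * v) := by fun_prop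
  rw [← integral_indicator measurableSet_Icc, integral_map hX
    (hc.stronglyMeasurable.indicator measurableSet_Icc).aestronglyMeasurable, constrainedCharFun]
  refine integral_congr_ae (.of_forall fun ω => ?_)
  by_cases h : X ω ∈ Set.Icc a b
  · simp only [Set.indicator_of_mem h, mul_one]
  · simp only [Set.indicator_of_notMem h, mul_zero]

theorem constrainedCharFun_eq_charFun {Ω : Type*} [MeasurableSpace Ω] (Q : Measure Ω) {X : Ω → ℝ}
    (hX : AEMeasurable X Q) (a b : ℝ) :
    (fun u : ℝ => constrainedCharFun Q X a b u) =
      charFun ((Q.map X).restrict (Set.Icc a b)) := by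
  ext u
  rw [constrainedCharFun_eq_setIntegral Q hX, charFun_apply_real]
  refine integral_congr_ae (.of_forall fun v => ?_)
  simp only
  congr 1
  ring

theorem memLp_id_restrict_Icc (μ : Measure ℝ) [IsFiniteMeasure μ] (a b : ℝ) (p : ENNReal) :
    MemLp id p (μ.restrict (Set.Icc a b)) := by
  refine MemLp.of_bound (by fun_prop) (max |a| |b|) ?_
  refine (ae_restrict_iff' measurableSet_Icc).2 (.of_forall fun x hx => ?_)
  exact abs_le_max_abs_abs hx.1 hx.2

theorem contDiff_constrainedCharFun {Ω : Type*} [MeasurableSpace Ω] (Q : Measure Ω)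
    [IsProbabilityMeasure Q] {X : Ω → ℝ} (hX : AEMeasurable X Q) (a b : ℝ) :
    ContDiff ℝ (⊤ : ℕ∞) (fun u : ℝ => constrainedCharFun Q X a b u) := by
  have := Measure.isProbabilityMeasure_map hX
  rw [constrainedCharFun_eq_charFun Q hX]
  exact contDiff_charFun' fun k => memLp_id_restrict_Icc _ a b k

theorem iteratedDeriv_constrainedCharFun_zero {Ω : Type*} [MeasurableSpace Ω] (Q : Measure Ω)
    [IsProbabilityMeasure Q] {X : Ω → ℝ} (hX : AEMeasurable X Q) (a b : ℝ) (n : ℕ) :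
    iteratedDeriv n (fun u : ℝ => constrainedCharFun Q X a b u) 0 =
      Complex.I ^ n * ((∫ ω, X ω ^ n *
        (Set.Icc a b).indicator (fun _ => (1 : ℝ)) (X ω) ∂Q : ℝ) : ℂ) := by
  have := Measure.isProbabilityMeasure_map hX
  rw [constrainedCharFun_eq_charFun Q hX,
    iteratedDeriv_charFun_zero (memLp_id_restrict_Icc _ a b n)]
  congr 2
  have hc : Continuous fun v : ℝ => v ^ n := by fun_prop
  rw [← integral_indicator measurableSet_Icc, integral_map hX
    (hc.stronglyMeasurable.indicator measurableSet_Icc).aestronglyMeasurable]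
  refine integral_congr_ae (.of_forall fun ω => ?_)
  by_cases h : X ω ∈ Set.Icc a b
  · simp only [Set.indicator_of_mem h, mul_one]
  · simp only [Set.indicator_of_notMem h, mul_zero]

/-- Inversion and constrained moments for a random variable with characteristic function `g`. -/
theorem constrained_of_charFun_eq_g {Ω : Type*} [MeasurableSpace Ω] (Q : Measure Ω)
    [IsProbabilityMeasure Q] {X : Ω → ℝ} (hX : AEMeasurable X Q)
    (pF pV : Fin 2 → FactorParams) (A : Matrix (Fin 2) (Fin 2) ℝ) {T : ℝ} (hT : 0 < T)
    (hg : ∀ x : ℝ, ∫ ω, Complex.exp (Complex.I * x * X ω) ∂Q = g pF pV A T x)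
    {a b : ℝ} (hab : a ≤ b) :
    (∀ u : ℝ, Integrable (fun y : ℝ => f y a b * g pF pV A T (u - y)) ∧
      constrainedCharFun Q X a b u =
        -(Complex.I / (2 * Real.pi)) * ∫ y : ℝ, f y a b * g pF pV A T (u - y)) ∧
    (∀ n : ℕ, 1 ≤ n →
      (∀ j ∈ Finset.range n, Integrable (derivIntegrand pF pV A T a b n j)) ∧
      iteratedDeriv n (fun u : ℝ => constrainedCharFun Q X a b u) 0 =
        -(Complex.I / (2 * Real.pi)) * ∑ j ∈ Finset.range n, ((n - 1).choose j : ℂ) *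
          ∫ y : ℝ, derivIntegrand pF pV A T a b n j y) := by
  have := Measure.isProbabilityMeasure_map hX
  have hφ : charFun (Q.map X) = g pF pV A T :=
    funext fun x => (charFun_map_eq Q hX x).trans (hg x)
  have hgi : Integrable (g pF pV A T) := by
    simpa using integrable_iteratedDeriv_g pF pV A hT 0
  have hinv : ∀ u : ℝ, constrainedCharFun Q X a b u =
        -(Complex.I / (2 * Real.pi)) * ∫ y : ℝ, f y a b * g pF pV A T (u - y) := by
    intro u
    rw [constrainedCharFun_eq_setIntegral Q hX,
      setIntegral_exp_eq_integral_f _ (hφ ▸ hgi) hab, hφ]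
  refine ⟨fun u => ⟨integrable_f_mul (hgi.comp_sub_left u) a b, hinv u⟩, fun n hn => ?_⟩
  obtain ⟨h1, h2⟩ := derivIntegrand_spec pF pV A hT a b hn
  obtain ⟨hs, hb⟩ := g_regularity pF pV A hT
  refine ⟨fun j _ => h1 j, ?_⟩
  rw [funext hinv, iteratedDeriv_const_mul_field, iteratedDeriv_integral_f_mul hs hb]
  simp_rw [h2]
  rw [integral_finsetSum _ fun j _ => (h1 j).const_mul _]
  simp_rw [integral_const_mul]

/-! ### Pathwise solution of the Ornstein-Uhlenbeck equation -/

/-- Integrating factor: the primitive `J` of `x` satisfies `J' + λJ = x0 + ζ`, so `(exp(λt) J)' =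
exp(λt)(x0 + ζ)`. As `ζ` may jump, this holds only for right derivatives, which suffice for the
fundamental theorem since `J` is continuous. -/
theorem integral_eq_of_linear_equation {lam T x0 : ℝ} (hl : lam ≠ 0) (hT : 0 < T) {x ζ : ℝ → ℝ}
    (hx : IntervalIntegrable x volume 0 T)
    (hζ : ∀ t, 0 ≤ t → ContinuousWithinAt ζ (Set.Ioi t) t)
    (h : ∀ t, 0 ≤ t → x t = x0 - lam * (∫ s in (0 : ℝ)..t, x s) + ζ t) :
    ∫ s in (0 : ℝ)..T, x s = lam⁻¹ * (1 - Real.exp (-lam * T)) * x0 +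
      ∫ s in (0 : ℝ)..T, Real.exp (-lam * (T - s)) * ζ s := by
  set J : ℝ → ℝ := fun t => ∫ s in (0 : ℝ)..t, x s with hJ
  have hJc : ContinuousOn J (Set.uIcc 0 T) :=
    intervalIntegral.continuousOn_primitive_interval' hx Set.left_mem_uIcc
  have hJd : ∀ t ∈ Set.Ioo 0 T, HasDerivWithinAt J (x t) (Set.Ioi t) t := by
    intro t ht
    have hJt : ContinuousAt J t := hJc.continuousAt (by
      rw [Set.uIcc_of_le hT.le]; exact Icc_mem_nhds ht.1 ht.2)
    have hxc : ContinuousWithinAt x (Set.Ioi t) t := by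
      have h1 : ContinuousWithinAt (fun t => x0 - lam * J t + ζ t) (Set.Ioi t) t :=
        (continuousWithinAt_const.sub
          (continuousWithinAt_const.mul hJt.continuousWithinAt)).add (hζ t ht.1.le)
      exact h1.congr (fun s hs => h s (ht.1.trans hs).le) (h t ht.1.le)
    refine (intervalIntegral.integral_hasDerivWithinAt_right (s := Set.Ici t) (t := Set.Ioi t)
      (hx.mono_set ?_) ?_ hxc).mono Set.Ioi_subset_Ici_self
    · rw [Set.uIcc_of_le hT.le, Set.uIcc_of_le ht.1.le]
      exact Set.Icc_subset_Icc_right ht.2.le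
    · exact ⟨Set.Ioc 0 T, nhdsWithin_le_nhds (Ioc_mem_nhds ht.1 ht.2), hx.1.aestronglyMeasurable⟩
  -- Integrability of `ζ` is read off from the equation itself.
  have hζi : IntervalIntegrable ζ volume 0 T := by
    have h1 : IntervalIntegrable (fun t => x t - x0 + lam * J t) volume 0 T :=
      (hx.sub intervalIntegrable_const).add (hJc.intervalIntegrable.const_mul lam)
    refine h1.congr fun t ht => ?_
    rw [Set.uIoc_of_le hT.le] at ht
    rw [h t ht.1.le]; ring
  have hexp : ∀ t, HasDerivAt (fun t => Real.exp (lam * t)) (lam * Real.exp (lam * t)) t := by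
    intro t
    have := ((hasDerivAt_id t).const_mul lam).exp
    simpa [mul_comm] using this
  have key := intervalIntegral.integral_eq_sub_of_hasDeriv_right (a := 0) (b := T)
    (f := fun t => Real.exp (lam * t) * J t) (f' := fun t => Real.exp (lam * t) * (x0 + ζ t))
    (ContinuousOn.mul (by fun_prop) hJc)
    (fun t ht => by
      rw [min_eq_left hT.le, max_eq_right hT.le] at ht
      refine ((hexp t).hasDerivWithinAt.mul (hJd t ht)).congr_deriv ?_
      rw [h t ht.1.le]; ring)
    ((intervalIntegrable_const.add hζi).continuousOn_mul (by fun_prop))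
  have hJ0 : J 0 = 0 := by simp [hJ]
  rw [hJ0, mul_zero, sub_zero] at key
  have e1 : J T = Real.exp (-lam * T) * ∫ t in (0 : ℝ)..T, Real.exp (lam * t) * (x0 + ζ t) := by
    rw [key, ← mul_assoc, ← Real.exp_add]; simp
  have e2 : ∀ t, Real.exp (lam * t) * (x0 + ζ t) =
      x0 * Real.exp (lam * t) + Real.exp (lam * t) * ζ t := fun t => by ring
  have e3 : ∫ t in (0 : ℝ)..T, Real.exp (lam * t) = (Real.exp (lam * T) - 1) / lam := by
    rw [intervalIntegral.integral_comp_mul_left Real.exp hl, integral_exp]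
    simp [div_eq_inv_mul]
  simp_rw [e2] at e1
  rw [intervalIntegral.integral_add (Continuous.intervalIntegrable (by fun_prop) _ _)
    (hζi.continuousOn_mul (by fun_prop)), intervalIntegral.integral_const_mul, e3, mul_add,
    ← intervalIntegral.integral_const_mul] at e1
  change J T = _
  rw [e1]
  congr 1
  · have : Real.exp (-lam * T) * Real.exp (lam * T) = 1 := by rw [← Real.exp_add]; simp
    rw [div_eq_inv_mul]
    linear_combination (lam⁻¹ * x0) * this
  · refine intervalIntegral.integral_congr fun t _ => ?_
    rw [← mul_assoc, ← Real.exp_add]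
    congr 2; ring

/-! ### Riemann sums -/

theorem norm_integral_sub_sum_le {E : Type*} [NormedAddCommGroup E] [NormedSpace ℝ E] {F : ℝ → E}
    {N : ℕ} {s : ℕ → ℝ} (hF : ∀ k < N, IntervalIntegrable F volume (s k) (s (k + 1)))
    {c : ℕ → E} {δ : ℕ → ℝ}
    (h : ∀ k < N, ‖(∫ t in s k..s (k + 1), F t) - c k‖ ≤ δ k) :
    ‖(∫ t in s 0..s N, F t) - ∑ k ∈ Finset.range N, c k‖ ≤ ∑ k ∈ Finset.range N, δ k := by
  rw [← intervalIntegral.sum_integral_adjacent_intervals hF, ← Finset.sum_sub_distrib]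
  exact (norm_sum_le _ _).trans (Finset.sum_le_sum fun k hk => h k (Finset.mem_range.1 hk))

/-- The equidistant grid of `[0, T]` with `n + 1` steps. -/
noncomputable def grid (T : ℝ) (n k : ℕ) : ℝ := k * (T / (n + 1))

theorem grid_zero (T : ℝ) (n : ℕ) : grid T n 0 = 0 := by simp [grid]

theorem grid_last (T : ℝ) (n : ℕ) : grid T n (n + 1) = T := by
  have : (n + 1 : ℝ) ≠ 0 := by positivity
  simp [grid]; field_simp

theorem grid_succ (T : ℝ) (n k : ℕ) : grid T n (k + 1) = grid T n k + T / (n + 1) := by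
  simp [grid]; ring

theorem grid_mono {T : ℝ} (hT : 0 ≤ T) (n : ℕ) : Monotone (grid T n) := by
  refine monotone_nat_of_le_succ fun k => ?_
  rw [grid_succ]
  have : 0 ≤ T / (n + 1 : ℝ) := by positivity
  linarith

theorem tendsto_const_div_nat (C : ℝ) : Tendsto (fun n : ℕ => C / (n + 1 : ℝ)) atTop (𝓝 0) := by
  simpa [div_eq_mul_inv] using tendsto_one_div_add_atTop_nhds_zero_nat.const_mul C

/-- The weight `(1 - exp(-λ(T - s))) / λ` of an increment at time `s`. -/
noncomputable def weight (lam T s : ℝ) : ℝ := lam⁻¹ * (1 - Real.exp (-lam * (T - s)))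

theorem hasDerivAt_weight {lam : ℝ} (hl : lam ≠ 0) (T s : ℝ) :
    HasDerivAt (weight lam T) (-Real.exp (-lam * (T - s))) s := by
  have h1 : HasDerivAt (fun s : ℝ => -lam * (T - s)) lam s := by
    have := ((hasDerivAt_id s).const_sub T).const_mul (-lam)
    simpa using this
  refine ((h1.exp.const_sub 1).const_mul lam⁻¹).congr_deriv ?_
  field_simp

theorem continuous_weight (lam T : ℝ) : Continuous (weight lam T) := by
  unfold weight; fun_prop

/-- Weighted sums of the increments of a monotone path converge to its integral. -/
theorem tendsto_weighted_increments {lam T : ℝ} (hl : 0 < lam) (hT : 0 < T) {ζ : ℝ → ℝ}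
    (hm : Monotone ζ) (h0 : ζ 0 = 0) :
    Tendsto (fun n : ℕ => ∑ k ∈ Finset.range (n + 1),
      (ζ (grid T n (k + 1)) - ζ (grid T n k)) * weight lam T (grid T n k)) atTop
      (𝓝 (∫ s in (0 : ℝ)..T, Real.exp (-lam * (T - s)) * ζ s)) := by
  -- Summation by parts; both boundary terms vanish, since the path starts at `0` and the weight is
  -- `0` at time `T`.
  have abel : ∀ n, ∑ k ∈ Finset.range (n + 1),
      (ζ (grid T n (k + 1)) - ζ (grid T n k)) * weight lam T (grid T n k) =
      ∑ k ∈ Finset.range (n + 1), ζ (grid T n (k + 1)) *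
        ∫ s in grid T n k..grid T n (k + 1), Real.exp (-lam * (T - s)) := by
    intro n
    have h1 : ∀ k, ∫ s in grid T n k..grid T n (k + 1), Real.exp (-lam * (T - s)) =
        weight lam T (grid T n k) - weight lam T (grid T n (k + 1)) := by
      intro k
      have := intervalIntegral.integral_eq_sub_of_hasDerivAt (a := grid T n k)
        (b := grid T n (k + 1)) (fun s _ => hasDerivAt_weight hl.ne' T s)
        (Continuous.intervalIntegrable (by fun_prop) _ _)
      rw [intervalIntegral.integral_neg] at this
      linarith
    simp_rw [h1]
    rw [← sub_eq_zero, ← Finset.sum_sub_distrib]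
    have h2 := Finset.sum_range_sub (fun k => ζ (grid T n k) * weight lam T (grid T n k)) (n + 1)
    rw [grid_last, grid_zero, h0] at h2
    have h3 : weight lam T T = 0 := by simp [weight]
    rw [h3] at h2
    rw [← (h2.trans (by ring) : _ = (0 : ℝ))]
    refine Finset.sum_congr rfl fun k _ => ?_
    ring
  simp_rw [abel]
  rw [tendsto_iff_norm_sub_tendsto_zero]
  refine squeeze_zero (fun _ => norm_nonneg _) (fun n => ?_) (tendsto_const_div_nat (T * ζ T))
  have hg := grid_mono hT.le n
  have hw : ∀ s ≤ T, |Real.exp (-lam * (T - s))| ≤ 1 := by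
    intro s hs
    rw [abs_of_pos (Real.exp_pos _), Real.exp_le_one_iff]
    nlinarith
  have hi : ∀ k, IntervalIntegrable (fun s => Real.exp (-lam * (T - s)) * ζ s) volume
      (grid T n k) (grid T n (k + 1)) := fun k =>
    hm.intervalIntegrable.continuousOn_mul (by fun_prop)
  have hb := norm_integral_sub_sum_le (N := n + 1) (fun k _ => hi k)
    (c := fun k => ζ (grid T n (k + 1)) *
        ∫ s in grid T n k..grid T n (k + 1), Real.exp (-lam * (T - s)))
    -- By monotonicity the error on a cell is at most increment times mesh; the increments
    -- telescope, so no continuity of the path is needed.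
    (δ := fun k => (ζ (grid T n (k + 1)) - ζ (grid T n k)) * (T / (n + 1))) (fun k hk => by
      have hkT : grid T n (k + 1) ≤ T := by
        simpa only [Nat.succ_eq_add_one, grid_last] using hg hk
      rw [← intervalIntegral.integral_const_mul, ← intervalIntegral.integral_sub (hi k)
        (Continuous.intervalIntegrable (by fun_prop) _ _)]
      refine (intervalIntegral.norm_integral_le_of_norm_le_const
        (C := ζ (grid T n (k + 1)) - ζ (grid T n k)) fun s hs => ?_).trans (le_of_eq ?_)
      · rw [Set.uIoc_of_le (hg k.le_succ)] at hs
        have h1 := hm hs.1.le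
        have h2 := hm hs.2
        rw [show Real.exp (-lam * (T - s)) * ζ s - ζ (grid T n (k + 1)) *
          Real.exp (-lam * (T - s)) = Real.exp (-lam * (T - s)) *
            (ζ s - ζ (grid T n (k + 1))) by ring, norm_mul, Real.norm_eq_abs, Real.norm_eq_abs,
          abs_of_nonpos (by linarith : ζ s - ζ (grid T n (k + 1)) ≤ 0)]
        calc _ ≤ 1 * -(ζ s - ζ (grid T n (k + 1))) :=
              mul_le_mul_of_nonneg_right (hw s (hs.2.trans hkT)) (by linarith)
          _ ≤ _ := by linarith
      · rw [grid_succ, add_sub_cancel_left, abs_of_nonneg (by positivity : 0 ≤ T / (n + 1 : ℝ))])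
  rw [← Finset.sum_mul, Finset.sum_range_sub (fun k => ζ (grid T n k)), grid_last, grid_zero, h0,
    sub_zero] at hb
  rw [norm_sub_rev]
  refine hb.trans (le_of_eq ?_)
  ring

/-- Riemann sums of the exponent along the weights. -/
theorem tendsto_sum_igExponent (p : FactorParams) {T : ℝ} (hT : 0 < T) (c : ℝ) :
    Tendsto (fun n : ℕ => ∑ k ∈ Finset.range (n + 1), ((p.lam * (T / (n + 1)) : ℝ) : ℂ) *
      igExponent p.a p.b (c * weight p.lam T (grid T n k))) atTop (𝓝 (igInt p T c)) := by
  have hl := p.lam_pos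
  -- Substituting `λ(T - s)` for the integration variable turns `1 - exp(-s)` into the weight at
  -- time `s`.
  have e : igInt p T c =
      ∫ s in (0 : ℝ)..T, (p.lam : ℂ) * igExponent p.a p.b (c * weight p.lam T s) := by
    rw [igInt_eq_integral]
    have h1 := intervalIntegral.integral_comp_mul_left (a := 0) (b := T)
      (fun s => igExponent p.a p.b (c / p.lam * (1 - Real.exp (-s)))) hl.ne'
    have h2 := intervalIntegral.integral_comp_sub_left (a := 0) (b := T)
      (fun s => igExponent p.a p.b (c / p.lam * (1 - Real.exp (-(p.lam * s))))) T
    simp only [sub_zero, sub_self, mul_zero] at h1 h2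
    rw [intervalIntegral.integral_const_mul]
    have h3 : ∫ s in (0 : ℝ)..T, igExponent p.a p.b (c * weight p.lam T s) =
        ∫ s in (0 : ℝ)..T, igExponent p.a p.b (c / p.lam * (1 - Real.exp (-(p.lam * (T - s))))) := by
      refine intervalIntegral.integral_congr fun s _ => ?_
      simp only [weight]
      congr 1
      rw [neg_mul]; ring
    rw [h3, h2, h1, Complex.real_smul, ← mul_assoc]
    have : (p.lam : ℂ) ≠ 0 := by exact_mod_cast hl.ne'
    push_cast
    field_simp
  obtain ⟨C, hC⟩ := norm_igExponentDeriv_le p.a p.b_pos (k := 1) le_rfl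
  have hC0 : 0 ≤ C := (norm_nonneg _).trans (hC 0)
  have hcont : Continuous fun s => (p.lam : ℂ) * igExponent p.a p.b (c * weight p.lam T s) :=
    continuous_const.mul ((continuous_igExponent p.a p.b_pos).comp
      (continuous_const.mul (continuous_weight _ _)))
  -- The integrand is Lipschitz, as `Ψ'` is bounded and the weight has slope at most one in modulus
  -- on `s ≤ T`. The total Riemann error is thus of order `1/(n + 1)`.
  have hlip : ∀ s ≤ T, ∀ s' ≤ T, ‖igExponent p.a p.b (c * weight p.lam T s) -
      igExponent p.a p.b (c * weight p.lam T s')‖ ≤ C * |c| * ‖s - s'‖ := by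
    intro s hs s' hs'
    refine Convex.norm_image_sub_le_of_norm_hasDerivWithin_le (s := Set.Iic T)
      (f := fun s => igExponent p.a p.b (c * weight p.lam T s))
      (f' := fun s => (c * -Real.exp (-p.lam * (T - s))) •
        igExponentDeriv p.a p.b 1 (c * weight p.lam T s)) (fun s _ => ?_) (fun s hs => ?_)
      (convex_Iic T) hs' hs
    · have h1 : HasDerivAt (igExponent p.a p.b)
          (igExponentDeriv p.a p.b 1 (c * weight p.lam T s)) (c * weight p.lam T s) := by
        rw [funext (igExponent_eq p.a p.b)]
        exact (hasDerivAt_igExponentDeriv p.a p.b_pos 0 _).add_const _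
      exact (h1.scomp s ((hasDerivAt_weight hl.ne' T s).const_mul c)).hasDerivWithinAt
    · have h2 : Real.exp (-p.lam * (T - s)) ≤ 1 := by
        rw [Real.exp_le_one_iff]
        have : s ≤ T := hs
        nlinarith
      rw [norm_smul, Real.norm_eq_abs, abs_mul, abs_neg, abs_of_pos (Real.exp_pos _), mul_comm]
      refine mul_le_mul (hC _) (mul_le_of_le_one_right (abs_nonneg _) h2) (by positivity) hC0
  rw [e, tendsto_iff_norm_sub_tendsto_zero]
  refine squeeze_zero (fun _ => norm_nonneg _) (fun n => ?_)
    (tendsto_const_div_nat (p.lam * (C * |c|) * T * T))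
  have hg := grid_mono hT.le n
  have hb := norm_integral_sub_sum_le (N := n + 1) (s := grid T n)
    (fun k _ => hcont.intervalIntegrable _ _)
    (c := fun k => ((p.lam * (T / (n + 1)) : ℝ) : ℂ) *
      igExponent p.a p.b (c * weight p.lam T (grid T n k)))
    (δ := fun k => p.lam * (C * |c| * (T / (n + 1))) * (T / (n + 1))) (fun k hk => by
      have hkT : grid T n (k + 1) ≤ T := by
        simpa only [Nat.succ_eq_add_one, grid_last] using hg hk
      have h1 : ((p.lam * (T / (n + 1)) : ℝ) : ℂ) *
          igExponent p.a p.b (c * weight p.lam T (grid T n k)) =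
          ∫ s in grid T n k..grid T n (k + 1),
            (p.lam : ℂ) * igExponent p.a p.b (c * weight p.lam T (grid T n k)) := by
        rw [intervalIntegral.integral_const, grid_succ, add_sub_cancel_left, Complex.real_smul]
        push_cast; ring
      rw [h1, ← intervalIntegral.integral_sub (hcont.intervalIntegrable _ _)
        intervalIntegrable_const]
      refine (intervalIntegral.norm_integral_le_of_norm_le_const
        (C := p.lam * (C * |c| * (T / (n + 1)))) fun s hs => ?_).trans (le_of_eq ?_)
      · rw [Set.uIoc_of_le (hg k.le_succ)] at hs
        rw [← mul_sub, norm_mul, Complex.norm_real, Real.norm_eq_abs, abs_of_pos hl]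
        refine mul_le_mul_of_nonneg_left ?_ hl.le
        refine (hlip s (hs.2.trans hkT) _ ((hg k.le_succ).trans hkT)).trans ?_
        refine mul_le_mul_of_nonneg_left ?_ (by positivity)
        have h2 := hs.2
        rw [grid_succ] at h2
        rw [Real.norm_eq_abs, abs_of_nonneg (by linarith [hs.1])]
        linarith
      · rw [grid_succ, add_sub_cancel_left, abs_of_nonneg (by positivity : 0 ≤ T / (n + 1 : ℝ))])
  rw [grid_zero, grid_last, Finset.sum_const, Finset.card_range, nsmul_eq_mul] at hb
  rw [norm_sub_rev]
  refine hb.trans (le_of_eq ?_)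
  push_cast
  have : (n + 1 : ℝ) ≠ 0 := by positivity
  field_simp

/-! ### The law of the integrated Ornstein-Uhlenbeck processes -/

section

variable {Ω : Type*} [MeasurableSpace Ω] {Q : Measure Ω}

theorem integral_exp_increment {a b : ℝ} {Z : ℝ≥0 → Ω → ℝ} (hZ : IsIGSubordinator a b Z Q)
    (s h : ℝ≥0) (c : ℝ) :
    ∫ ω, Complex.exp (Complex.I * c * ((Z (s + h) ω - Z s ω : ℝ) : ℂ)) ∂Q =
      Complex.exp (h * igExponent a b c) := by
  rw [← hZ.charFun_eq]
  exact ((hZ.stationary s h).comp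
    (u := fun x : ℝ => Complex.exp (Complex.I * c * x)) (by fun_prop)).integral_eq

theorem integral_exp_sum_increments {a b : ℝ} {Z : ℝ≥0 → Ω → ℝ} (hZ : IsIGSubordinator a b Z Q)
    (h : ℝ≥0) (c : ℕ → ℝ) (N : ℕ) :
    ∫ ω, Complex.exp (Complex.I * ((∑ k ∈ Finset.range N,
      (Z ((k + 1 : ℕ) * h) ω - Z (k * h) ω) * c k : ℝ) : ℂ)) ∂Q =
      Complex.exp (∑ k ∈ Finset.range N, (h : ℂ) * igExponent a b (c k)) := by
  have hmono : Monotone fun k : ℕ => (k : ℝ≥0) * h := fun i j hij => by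
    simp only; gcongr
  have hind := (hZ.indep_increments.nat hmono).precomp (Fin.val_injective (n := N))
  have key := hind.integral_fun_prod_comp (𝕜 := ℂ)
    (f := fun (i : Fin N) (x : ℝ) => Complex.exp (Complex.I * c i * x))
    (fun i => ((hZ.measurable _).sub (hZ.measurable _)).aemeasurable)
    (fun i => Continuous.aestronglyMeasurable (by fun_prop))
  have e : ∀ i : Fin N, ∫ ω, Complex.exp (Complex.I * c i *
      ((Z ((i + 1 : ℕ) * h) ω - Z (i * h) ω : ℝ) : ℂ)) ∂Q =
      Complex.exp ((h : ℂ) * igExponent a b (c i)) := by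
    intro i
    rw [← integral_exp_increment hZ (i * h) h (c i)]
    have : (i : ℝ≥0) * h + h = ((i + 1 : ℕ) : ℝ≥0) * h := by push_cast; ring
    rw [this]
  rw [Complex.exp_sum, Finset.prod_range]
  rw [← Finset.prod_congr rfl fun i _ => e i]
  refine Eq.trans (integral_congr_ae (.of_forall fun ω => ?_)) key
  simp only
  rw [← Complex.exp_sum, Finset.sum_range, Complex.ofReal_sum, Finset.mul_sum]
  congr 1
  refine Finset.sum_congr rfl fun i _ => ?_
  rw [Complex.ofReal_mul]
  ring

/-- The weighted sum of increments of the path `z`, run at speed `λ`, on the grid of `[0, T]`. -/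
noncomputable def pathSum (lam T : ℝ) (n : ℕ) (z : ℝ≥0 → ℝ) : ℝ :=
  ∑ k ∈ Finset.range (n + 1),
    (z ((k + 1 : ℕ) * (lam * (T / (n + 1))).toNNReal) - z (k * (lam * (T / (n + 1))).toNNReal)) *
      weight lam T (grid T n k)

/-- The sum reads finitely many coordinates of the path, so independence of the driving processes as
path-valued variables passes to these sums. -/
theorem measurable_pathSum (lam T : ℝ) (n : ℕ) : Measurable (pathSum lam T n) := by
  unfold pathSum
  fun_prop

theorem speed_grid {lam T : ℝ} (hl : 0 < lam) (n k : ℕ) :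
    lam.toNNReal * (grid T n k).toNNReal = k * (lam * (T / (n + 1))).toNNReal := by
  rw [grid, Real.toNNReal_mul hl.le, Real.toNNReal_mul (Nat.cast_nonneg k), Real.toNNReal_natCast]
  ring

theorem tendsto_pathSum {lam T : ℝ} (hl : 0 < lam) (hT : 0 < T) {z : ℝ≥0 → ℝ} (hm : Monotone z)
    (h0 : z 0 = 0) :
    Tendsto (fun n => pathSum lam T n z) atTop
      (𝓝 (∫ s in (0 : ℝ)..T, Real.exp (-lam * (T - s)) * z (lam.toNNReal * s.toNNReal))) := by
  have h := tendsto_weighted_increments hl hT (ζ := fun s => z (lam.toNNReal * s.toNNReal))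
    (fun s t hst => hm (by gcongr)) (by simpa using h0)
  refine h.congr fun n => ?_
  rw [pathSum]
  refine Finset.sum_congr rfl fun k _ => ?_
  rw [speed_grid hl, speed_grid hl]

theorem integral_exp_pathSum {p : FactorParams} {Z : ℝ≥0 → Ω → ℝ}
    (hZ : IsIGSubordinator p.a p.b Z Q) {T : ℝ} (hT : 0 < T) (c : ℝ) (n : ℕ) :
    ∫ ω, Complex.exp (Complex.I * ((c * pathSum p.lam T n (fun t => Z t ω) : ℝ) : ℂ)) ∂Q =
      Complex.exp (∑ k ∈ Finset.range (n + 1), ((p.lam * (T / (n + 1)) : ℝ) : ℂ) *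
        igExponent p.a p.b (c * weight p.lam T (grid T n k))) := by
  have hl := p.lam_pos
  have h := integral_exp_sum_increments hZ (p.lam * (T / (n + 1))).toNNReal
    (fun k => c * weight p.lam T (grid T n k)) (n + 1)
  rw [show (((p.lam * (T / (n + 1))).toNNReal : ℝ≥0) : ℂ) = ((p.lam * (T / (n + 1)) : ℝ) : ℂ) by
    have : ((p.lam * (T / (n + 1))).toNNReal : ℝ) = p.lam * (T / (n + 1)) :=
      Real.coe_toNNReal _ (by positivity)
    exact congrArg Complex.ofReal this] at h
  rw [← h]
  refine integral_congr_ae (.of_forall fun ω => ?_)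
  simp only [pathSum]
  rw [Finset.mul_sum]
  congr 3
  refine Finset.sum_congr rfl fun k _ => ?_
  ring

theorem IsOUProcess.integral_eq {p : FactorParams} {Z X : ℝ≥0 → Ω → ℝ}
    (hZ : IsIGSubordinator p.a p.b Z Q) (hX : IsOUProcess p Z X Q) {T : ℝ} (hT : 0 < T) :
    ∀ᵐ ω ∂Q, ∫ s in (0 : ℝ)..T, X s.toNNReal ω =
      p.lam⁻¹ * (1 - Real.exp (-p.lam * T)) * p.x0 +
      ∫ s in (0 : ℝ)..T, Real.exp (-p.lam * (T - s)) * Z (p.lam.toNNReal * s.toNNReal) ω := by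
  filter_upwards [hX.integrable, hX.eq, hZ.cadlag] with ω h1 h2 h3
  refine integral_eq_of_linear_equation p.lam_pos.ne' hT ?_ (fun t _ => ?_) (fun t ht => ?_)
  · have := h1 T.toNNReal
    rwa [Real.coe_toNNReal _ hT.le] at this
  · have hmap : Set.MapsTo (fun s : ℝ => p.lam.toNNReal * s.toNNReal) (Set.Ioi t)
        (Set.Ici (p.lam.toNNReal * t.toNNReal)) := fun s hs => by
      have : t ≤ s := le_of_lt hs
      exact mul_le_mul_of_nonneg_left (Real.toNNReal_le_toNNReal this) zero_le
    exact ContinuousWithinAt.comp (f := fun s : ℝ => p.lam.toNNReal * s.toNNReal)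
      (h3 _).1 (Continuous.continuousWithinAt (by fun_prop)) hmap
  · have := h2 t.toNNReal
    rwa [Real.coe_toNNReal _ ht] at this

/-- Solving the equation at time `T` for the integral expresses it through `X_T` and `Z_{λT}`, so
joint measurability of `X` in time and `ω` is not needed. -/
theorem IsOUProcess.aemeasurable_integral {p : FactorParams} {Z X : ℝ≥0 → Ω → ℝ}
    (hZ : IsIGSubordinator p.a p.b Z Q) (hX : IsOUProcess p Z X Q) {T : ℝ} (hT : 0 < T) :
    AEMeasurable (fun ω => ∫ s in (0 : ℝ)..T, X s.toNNReal ω) Q := by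
  have h : AEMeasurable (fun ω => p.lam⁻¹ *
      (p.x0 + Z (p.lam.toNNReal * T.toNNReal) ω - X T.toNNReal ω)) Q :=
    (((hZ.measurable _).const_add _).aemeasurable.sub (hX.aemeasurable _)).const_mul _
  refine h.congr ?_
  filter_upwards [hX.eq] with ω hω
  have := hω T.toNNReal
  rw [Real.coe_toNNReal _ hT.le] at this
  rw [this]
  have := p.lam_pos
  field_simp
  ring

/-- The joint characteristic function of the integrals of independent Ornstein-Uhlenbeck
processes driven by inverse Gaussian subordinators. -/
theorem integral_exp_sum_integral_ou [IsProbabilityMeasure Q] {ι : Type*} [Fintype ι]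
    {p : ι → FactorParams} {Z X : ι → ℝ≥0 → Ω → ℝ}
    (hZ : ∀ i, IsIGSubordinator (p i).a (p i).b (Z i) Q)
    (hind : iIndepFun (fun (i : ι) (ω : Ω) (t : ℝ≥0) => Z i t ω) Q)
    (hX : ∀ i, IsOUProcess (p i) (Z i) (X i) Q) {T : ℝ} (hT : 0 < T) (c : ι → ℝ) :
    ∫ ω, Complex.exp (Complex.I *
        ((∑ i, c i * ∫ s in (0 : ℝ)..T, X i s.toNNReal ω : ℝ) : ℂ)) ∂Q =
      Complex.exp (∑ i, (Complex.I *
        ((c i * ((p i).lam⁻¹ * (1 - Real.exp (-(p i).lam * T)) * (p i).x0) : ℝ) : ℂ) +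
          igInt (p i) T (c i))) := by
  set m : ι → ℝ := fun i => (p i).lam⁻¹ * (1 - Real.exp (-(p i).lam * T)) * (p i).x0 with hm
  have hpath : ∀ i, Measurable fun ω t => Z i t ω := fun i =>
    measurable_pi_lambda _ fun t => (hZ i).measurable t
  have hS : ∀ i n, Measurable fun ω => pathSum (p i).lam T n (fun t => Z i t ω) := fun i n =>
    (measurable_pathSum _ _ _).comp (hpath i)
  -- Almost sure convergence of the path sums, with exponentials of modulus one as domination.
  have l1 : Tendsto (fun n => ∫ ω, Complex.exp (Complex.I *
      ((∑ i, c i * (m i + pathSum (p i).lam T n (fun t => Z i t ω)) : ℝ) : ℂ)) ∂Q) atTop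
      (𝓝 (∫ ω, Complex.exp (Complex.I *
        ((∑ i, c i * ∫ s in (0 : ℝ)..T, X i s.toNNReal ω : ℝ) : ℂ)) ∂Q)) := by
    refine tendsto_integral_of_dominated_convergence (fun _ => 1) (fun n => ?_)
      (integrable_const _) (fun n => .of_forall fun ω => ?_) ?_
    · have : Measurable fun ω => ∑ i, c i * (m i + pathSum (p i).lam T n (fun t => Z i t ω)) :=
        Finset.measurable_fun_sum _ fun i _ => ((hS i n).const_add _).const_mul _
      exact Measurable.aestronglyMeasurable (by fun_prop)
    · rw [mul_comm, Complex.norm_exp_ofReal_mul_I]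
    · have h1 := eventually_all.2 fun i => (hX i).integral_eq (hZ i) hT
      have h2 := eventually_all.2 fun i => (hZ i).mono
      have h3 := eventually_all.2 fun i => (hZ i).zero
      filter_upwards [h1, h2, h3] with ω h1 h2 h3
      simp_rw [h1]
      have hcont : Continuous fun x : ℝ => Complex.exp (Complex.I * x) := by fun_prop
      refine (hcont.tendsto _).comp (tendsto_finsetSum _ fun i _ => ?_)
      exact ((tendsto_pathSum (p i).lam_pos hT (h2 i) (h3 i)).const_add _).const_mul _
  have e : ∀ n, ∫ ω, Complex.exp (Complex.I *
      ((∑ i, c i * (m i + pathSum (p i).lam T n (fun t => Z i t ω)) : ℝ) : ℂ)) ∂Q =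
      Complex.exp (∑ i, (Complex.I * ((c i * m i : ℝ) : ℂ) +
        ∑ k ∈ Finset.range (n + 1), (((p i).lam * (T / (n + 1)) : ℝ) : ℂ) *
          igExponent (p i).a (p i).b (c i * weight (p i).lam T (grid T n k)))) := by
    intro n
    -- At each finite stage independence across factors makes the expectation a product of the
    -- one-factor values.
    have key := hind.integral_fun_prod_comp (𝕜 := ℂ)
      (f := fun i (z : ℝ≥0 → ℝ) =>
        Complex.exp (Complex.I * ((c i * pathSum (p i).lam T n z : ℝ) : ℂ)))
      (fun i => (hpath i).aemeasurable)
      (fun i => by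
        have := (measurable_pathSum (p i).lam T n).const_mul (c i)
        exact Measurable.aestronglyMeasurable (by fun_prop))
    simp_rw [integral_exp_pathSum (hZ _) hT] at key
    rw [Finset.sum_add_distrib, Complex.exp_add, Complex.exp_sum Finset.univ
      (fun i => ∑ k ∈ Finset.range (n + 1), (((p i).lam * (T / (n + 1)) : ℝ) : ℂ) *
          igExponent (p i).a (p i).b (c i * weight (p i).lam T (grid T n k))), ← key,
      ← integral_const_mul]
    refine integral_congr_ae (.of_forall fun ω => ?_)
    simp only
    rw [← Complex.exp_sum, ← Complex.exp_add, ← Finset.sum_add_distrib, Complex.ofReal_sum,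
      Finset.mul_sum]
    congr 1
    refine Finset.sum_congr rfl fun i _ => ?_
    push_cast; ring
  have l2 : Tendsto (fun n : ℕ => Complex.exp (∑ i, (Complex.I * ((c i * m i : ℝ) : ℂ) +
        ∑ k ∈ Finset.range (n + 1), (((p i).lam * (T / (n + 1)) : ℝ) : ℂ) *
          igExponent (p i).a (p i).b (c i * weight (p i).lam T (grid T n k))))) atTop
      (𝓝 (Complex.exp (∑ i, (Complex.I * ((c i * m i : ℝ) : ℂ) + igInt (p i) T (c i))))) :=
    (Complex.continuous_exp.tendsto _).comp
      (tendsto_finsetSum _ fun i _ => (tendsto_sum_igExponent (p i) hT (c i)).const_add _)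
  exact tendsto_nhds_unique (l1.congr e) l2

end

/-! ### The integrated variance -/

/-- `M` is the rank-one matrix of the vector `(1, -1)`, so the trace is the square of that vector's
pairing with column `l` of `A`. -/
theorem loading_matM (A : Matrix (Fin 2) (Fin 2) ℝ) (l : Fin 2) :
    loading A matM l = (A 0 l - A 1 l) ^ 2 := by
  fin_cases l <;>
  · simp [loading, matM, Matrix.trace, Matrix.mul_apply, Fin.sum_univ_two, Matrix.single,
      Matrix.vecMul, dotProduct]
    ring

/-- Integrability of each path is what allows the entrywise integrals of `Σ` to be split into the
four factors. -/
theorem vPlus_eq {Ω : Type*} (A : Matrix (Fin 2) (Fin 2) ℝ) {F V : Fin 2 → ℝ≥0 → Ω → ℝ} {T : ℝ}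
    {ω : Ω} (hF : ∀ l, IntervalIntegrable (fun s : ℝ => F l s.toNNReal ω) volume 0 T)
    (hV : ∀ l, IntervalIntegrable (fun s : ℝ => V l s.toNNReal ω) volume 0 T) :
    vPlus A F V T ω = ∑ l, (∫ s in (0 : ℝ)..T, F l s.toNNReal ω) +
      ∑ l, loading A matM l * ∫ s in (0 : ℝ)..T, V l s.toNNReal ω := by
  have e : ∀ j k, intCov A F V T ω j k =
      (if j = k then ∫ s in (0 : ℝ)..T, F j s.toNNReal ω else 0) +
        ∑ l, A j l * A k l * ∫ s in (0 : ℝ)..T, V l s.toNNReal ω := by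
    intro j k
    have e1 : ∀ s : ℝ, covProcess A F V s.toNNReal ω j k =
        (if j = k then 1 else 0) * F j s.toNNReal ω +
          (A j 0 * A k 0 * V 0 s.toNNReal ω + A j 1 * A k 1 * V 1 s.toNNReal ω) := by
      intro s
      simp [covProcess, Matrix.mul_apply, Fin.sum_univ_two, Matrix.diagonal_apply]
      ring
    simp only [intCov, Matrix.of_apply]
    simp_rw [e1]
    rw [intervalIntegral.integral_add ((hF j).const_mul _)
      (((hV 0).const_mul _).add ((hV 1).const_mul _)),
      intervalIntegral.integral_add ((hV 0).const_mul _) ((hV 1).const_mul _)]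
    simp only [intervalIntegral.integral_const_mul, Fin.sum_univ_two]
    split_ifs <;> simp
  rw [vPlus, Matrix.trace]
  simp only [Fin.sum_univ_two, Matrix.diag_apply, Matrix.mul_apply, e, loading_matM]
  simp [matM]
  ring

section

variable {Ω : Type*} [MeasurableSpace Ω] {Q : Measure Ω} {pF pV : Fin 2 → FactorParams}
  {ZF ZV F V : Fin 2 → ℝ≥0 → Ω → ℝ}

theorem ae_vPlus_eq (A : Matrix (Fin 2) (Fin 2) ℝ) (hF : ∀ l, IsOUProcess (pF l) (ZF l) (F l) Q)
    (hV : ∀ l, IsOUProcess (pV l) (ZV l) (V l) Q) {T : ℝ} (hT : 0 < T) :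
    ∀ᵐ ω ∂Q, vPlus A F V T ω = ∑ i : Fin 2 ⊕ Fin 2, Sum.elim (fun _ => 1) (loading A matM) i *
      ∫ s in (0 : ℝ)..T, Sum.elim F V i s.toNNReal ω := by
  filter_upwards [eventually_all.2 fun l => (hF l).integrable,
    eventually_all.2 fun l => (hV l).integrable] with ω h1 h2
  rw [vPlus_eq A (fun l => by simpa [hT.le] using h1 l T.toNNReal)
    (fun l => by simpa [hT.le] using h2 l T.toNNReal)]
  simp [Fintype.sum_sum_type]

theorem aemeasurable_vPlus (A : Matrix (Fin 2) (Fin 2) ℝ)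
    (hZF : ∀ l, IsIGSubordinator (pF l).a (pF l).b (ZF l) Q)
    (hZV : ∀ l, IsIGSubordinator (pV l).a (pV l).b (ZV l) Q)
    (hF : ∀ l, IsOUProcess (pF l) (ZF l) (F l) Q)
    (hV : ∀ l, IsOUProcess (pV l) (ZV l) (V l) Q) {T : ℝ} (hT : 0 < T) :
    AEMeasurable (vPlus A F V T) Q := by
  refine AEMeasurable.congr ?_ (ae_eq_symm (ae_vPlus_eq A hF hV hT))
  refine Finset.aemeasurable_fun_sum _ fun i _ => AEMeasurable.const_mul ?_ _
  rcases i with l | l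
  · exact (hF l).aemeasurable_integral (hZF l) hT
  · exact (hV l).aemeasurable_integral (hZV l) hT

theorem integral_exp_vPlus [IsProbabilityMeasure Q] (A : Matrix (Fin 2) (Fin 2) ℝ)
    (hZF : ∀ l, IsIGSubordinator (pF l).a (pF l).b (ZF l) Q)
    (hZV : ∀ l, IsIGSubordinator (pV l).a (pV l).b (ZV l) Q)
    (hind : iIndepFun (fun (i : Fin 2 ⊕ Fin 2) (ω : Ω) (t : ℝ≥0) => Sum.elim ZF ZV i t ω) Q)
    (hF : ∀ l, IsOUProcess (pF l) (ZF l) (F l) Q)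
    (hV : ∀ l, IsOUProcess (pV l) (ZV l) (V l) Q) {T : ℝ} (hT : 0 < T) (x : ℝ) :
    ∫ ω, Complex.exp (Complex.I * x * vPlus A F V T ω) ∂Q = g pF pV A T x := by
  have key := integral_exp_sum_integral_ou (p := Sum.elim pF pV) (Z := Sum.elim ZF ZV)
    (X := Sum.elim F V) (by rintro (l | l); exacts [hZF l, hZV l]) hind
    (by rintro (l | l); exacts [hF l, hV l]) hT
    (fun i => x * Sum.elim (fun _ => 1) (loading A matM) i)
  have h1 : ∫ ω, Complex.exp (Complex.I * x * vPlus A F V T ω) ∂Q =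
      ∫ ω, Complex.exp (Complex.I * ((∑ i : Fin 2 ⊕ Fin 2,
        x * Sum.elim (fun _ => 1) (loading A matM) i *
          ∫ s in (0 : ℝ)..T, Sum.elim F V i s.toNNReal ω : ℝ) : ℂ)) ∂Q := by
    refine integral_congr_ae ?_
    filter_upwards [ae_vPlus_eq A hF hV hT] with ω hω
    simp_rw [hω, mul_assoc, ← Finset.mul_sum]
    push_cast
    rfl
  rw [h1, key, g]
  congr 1
  rw [Fintype.sum_sum_type, Finset.sum_add_distrib, Finset.sum_add_distrib, ← Finset.mul_sum,
    ← Finset.mul_sum, K1, K2]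
  simp only [Sum.elim_inl, Sum.elim_inr, loading_smul]
  have hM : ∀ l : Fin 2, (x • matM) l l = x * 1 := by
    intro l; fin_cases l <;> simp [matM]
  simp only [hM, mul_assoc]

end

end OUCov

/-! ### Constrained characteristic function and moments of the integrated variance -/

theorem proposition3p3 {Ω : Type*} [MeasurableSpace Ω] (Q : Measure Ω) [IsProbabilityMeasure Q]
    (pF pV : Fin 2 → OUCov.FactorParams)
    (A : Matrix (Fin 2) (Fin 2) ℝ) (hA : A ∈ Matrix.orthogonalGroup (Fin 2) ℝ)
    (ZF ZV F V : Fin 2 → ℝ≥0 → Ω → ℝ)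
    (hZF : ∀ l, OUCov.IsIGSubordinator (pF l).a (pF l).b (ZF l) Q)
    (hZV : ∀ l, OUCov.IsIGSubordinator (pV l).a (pV l).b (ZV l) Q)
    (hind : iIndepFun (fun (i : Fin 2 ⊕ Fin 2) (ω : Ω) (t : ℝ≥0) => Sum.elim ZF ZV i t ω) Q)
    (hF : ∀ l, OUCov.IsOUProcess (pF l) (ZF l) (F l) Q)
    (hV : ∀ l, OUCov.IsOUProcess (pV l) (ZV l) (V l) Q)
    (T : ℝ) (hT : 0 < T) (a b : ℝ) (hab : a ≤ b) :
    -- `g` is the characteristic function of `v_T^+`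
    (∀ x : ℝ, ∫ ω, Complex.exp (Complex.I * x * OUCov.vPlus A F V T ω) ∂Q =
      OUCov.g pF pV A T x) ∧
    -- the constrained characteristic function
    (∀ u : ℝ,
      Integrable (fun y : ℝ => OUCov.f y a b * OUCov.g pF pV A T (u - y)) ∧
      OUCov.constrainedCharFun Q (OUCov.vPlus A F V T) a b u =
        -(Complex.I / (2 * Real.pi)) * ∫ y : ℝ, OUCov.f y a b * OUCov.g pF pV A T (u - y)) ∧
    -- all the derivatives below exist
    ContDiff ℝ (⊤ : ℕ∞) (fun x : ℝ => OUCov.K1 pF T (x • OUCov.matM)) ∧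
    ContDiff ℝ (⊤ : ℕ∞) (fun x : ℝ => OUCov.K2 pV A T (x • OUCov.matM)) ∧
    ContDiff ℝ (⊤ : ℕ∞) (fun u : ℝ => OUCov.constrainedCharFun Q (OUCov.vPlus A F V T) a b u) ∧
    -- its derivatives at zero
    (∀ n : ℕ, 1 ≤ n →
      (∀ j ∈ Finset.range n, Integrable (OUCov.derivIntegrand pF pV A T a b n j)) ∧
      iteratedDeriv n (fun u : ℝ => OUCov.constrainedCharFun Q (OUCov.vPlus A F V T) a b u) 0 =
        -(Complex.I / (2 * Real.pi)) * ∑ j ∈ Finset.range n, ((n - 1).choose j : ℂ) *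
          ∫ y : ℝ, OUCov.derivIntegrand pF pV A T a b n j y) ∧
    -- which give the constrained moments
    (∀ n : ℕ,
      iteratedDeriv n (fun u : ℝ => OUCov.constrainedCharFun Q (OUCov.vPlus A F V T) a b u) 0 =
        Complex.I ^ n * ((∫ ω, OUCov.vPlus A F V T ω ^ n *
          (Set.Icc a b).indicator (fun _ => (1 : ℝ)) (OUCov.vPlus A F V T ω) ∂Q : ℝ) : ℂ)) := by
  have hX := OUCov.aemeasurable_vPlus A hZF hZV hF hV hT
  have hg := OUCov.integral_exp_vPlus A hZF hZV hind hF hV hT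
  obtain ⟨D1, hD1, hd1⟩ := OUCov.exists_hasDerivAt_K1 pF T
  obtain ⟨D2, hD2, hd2⟩ := OUCov.exists_hasDerivAt_K2 pV A T
  obtain ⟨h1, h2⟩ := OUCov.constrained_of_charFun_eq_g Q hX pF pV A hT hg hab
  exact ⟨hg, h1, OUCov.contDiff_of_hasDerivAt hd1 hD1, OUCov.contDiff_of_hasDerivAt hd2 hD2,
    OUCov.contDiff_constrainedCharFun Q hX a b, h2,
    OUCov.iteratedDeriv_constrainedCharFun_zero Q hX a b⟩
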